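/- **Conventions.** An $n$-punctured ball tangle diagram is a link-type diagram in a disc with $n$ disjoint open discs (the holes $1,\dots,n$) removed, whose strands end at exactly four marked points NE, NW, SW, SE on the outer circle and on the boundary circle of each hole (listed counterclockwise); closed components are allowed. For $n=0$ it is a ball tangle diagram, for $n=1$ a spherical tangle diagram. If $T$ is an $n$-punctured diagram and $B^{(1)},\dots,B^{(n)}$ are punctured diagrams, $T(B^{(1)},\dots,B^{(n)})$ is obtained by putting $B^{(i)}$ into the $i$-th hole, matching marked points of the same name. For a link diagram $L$ with at least one component let $$\langle L\rangle=\sum_{\sigma}A^{\alpha(\sigma)-\beta(\sigma)}(-A^2-A^{-2})^{d(\sigma)-1},\qquad A=e^{i\pi/4},$$ be its Kauffman bracket, where $\sigma$ runs over the states, $\alpha(\sigma),\beta(\sigma)$ are the numbers of A- and B-splittings, $d(\sigma)$ is the number of circles, and $0^0=1$. For a ball tangle diagram $B$ let $B_1$ be its numerator closure (NE joined to NW, SE joined to SW outside the disc) and $B_2$ its denominator closure (NE joined to SE, NW joined to SW). The fundamental tangle $1$ consists of the two vertical arcs NE–SE, NW–SW, and the fundamental tangle $2$ of the two horizontal arcs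 NE–NW, SE–SW. For an $n$-punctured diagram $T$, $j\in\{1,2\}$ and $\alpha\in\{1,2\}^n$, let $T_{j\alpha}$ be the closure $j$ of $T$ with its $i$-th hole filled by the fundamental tangle $\alpha_i$ for all $i$. For an integral matrix $M$ write $[M]=\{M,-M\}$; the determinant of $[M]$ is $\det M$ for $M$ of size $2\times2$, which is independent of the sign. Put $\Phi=\{z\in\mathbb C: z^8=1\}$ and $$f(B)=\left\{\begin{pmatrix} z\langle B_1\rangle\\ iz\langle B_2\rangle\end{pmatrix}: z\in\Phi\right\}\cap M_{2\times1}(\mathbb Z),\qquad F(T)=\left\{\begin{pmatrix} z\langle T_{1(1)}\rangle & -iz\langle T_{1(2)}\rangle\\ iz\langle T_{2(1)}\rangle & z\langle T_{2(2)}\rangle\end{pmatrix}: z\in\Phi\right\}\cap M_{2\times2}(\mathbb Z)$$ for a ball tangle diagram $B$ and a spherical tangle diagram $T$. Let $I$ be the spherical tangle diagram without crossings in which each outer marked point is joined radially to the marked point of the hole with the same name. Let $T^5$ be the following $5$-punctured ball tangle diagram without crossings. The holes $1,2,3,4$ lie at the corners NW, NE, SW, SE, respectively, of a square and the hole $5$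 lies at its centre. The outer points NW, NE, SW, SE are joined to the points of the same names of the holes $1,2,3,4$, respectively. The points NW, NE, SW, SE of the hole $5$ are joined to the point SE of hole $1$, the point SW of hole $2$, the point NE of hole $3$ and the point NW of hole $4$, respectively. The remaining arcs join NE of hole $1$ to NW of hole $2$, SW of hole $1$ to NW of hole $3$, SE of hole $2$ to NE of hole $4$, and SE of hole $3$ to SW of hole $4$. **Theorem.** Let $B^{(1)},\dots,B^{(4)}$ be ball tangle diagrams and let $p_i,q_i\in\mathbb Z$ with $f(B^{(i)})=\left[\begin{matrix}p_i\\ q_i\end{matrix}\right]$ for $i=1,2,3,4$. Let $X=T^5(B^{(1)},B^{(2)},B^{(3)},B^{(4)},I)$. Then $$F(X)=\left[\begin{matrix} p_1p_2p_3q_4+p_1p_2q_3p_4+p_1q_2p_3p_4+q_1p_2p_3p_4 & -p_1q_2p_3q_4-p_1q_2q_3p_4-q_1p_2p_3q_4-q_1p_2q_3p_4\\ p_1p_2q_3q_4+p_1q_2q_3p_4+q_1p_2p_3q_4+q_1q_2p_3p_4 & -p_1q_2q_3q_4-q_1p_2q_3q_4-q_1q_2p_3q_4-q_1q_2q_3p_4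 \end{matrix}\right],$$ and $$\det F(X)=(p_1q_2q_3p_4-q_1p_2p_3q_4)^2 .$$ -/

import Mathlib

namespace PunctTangle

/-! ### Diagrams

A diagram is recorded as a combinatorial map (a planar diagram code with a rotation system).  Its
vertices are discs and points: the outside of the big disc, the holes, the crossings, and
finitely many auxiliary 2-valent points lying on strands ("joints"; a circle without crossings is
drawn with at least one joint).  A leg is one end of a strand segment at one of these vertices.

The four boundary points of the outer disc and of each hole are numbered counterclockwise in the
projection plane: `0 = NE`, `1 = NW`, `2 = SW`, `3 = SE`.  The four legs of a crossing are numbered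
counterclockwise so that `0, 2` are the two ends of the under-strand and `1, 3` the two ends of
the over-strand. -/

/-- Legs of a tangle diagram with hole set `H`, crossing set `C`, joint set `J`. -/
inductive Leg (H C J : Type) : Type
  | outer (j : Fin 4)
  | hole (h : H) (j : Fin 4)
  | crossing (c : C) (j : Fin 4)
  | joint (p : J) (s : Bool)

/-- Legs of a link diagram with crossing set `C` and joint set `J`. -/
inductive LinkLeg (C J : Type) : Type
  | crossing (c : C) (j : Fin 4)
  | joint (p : J) (s : Bool)

/-- Combinatorial diagram of a punctured ball tangle whose holes are indexed by `H`; the strand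
segments are the pairs `{x, arc x}`.  Drawability in the plane is the predicate `IsPlanar`. -/
structure TangleDiagram (H : Type) where
  Crossing : Type
  Joint : Type
  [fintypeCrossing : Fintype Crossing]
  [decEqCrossing : DecidableEq Crossing]
  [fintypeJoint : Fintype Joint]
  arc : Leg H Crossing Joint → Leg H Crossing Joint
  arc_arc : ∀ x, arc (arc x) = x
  arc_ne : ∀ x, arc x ≠ x

/-- Combinatorial link diagram. -/
structure LinkDiagram where
  Crossing : Type
  Joint : Type
  [fintypeCrossing : Fintype Crossing]
  [decEqCrossing : DecidableEq Crossing]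
  [fintypeJoint : Fintype Joint]
  arc : LinkLeg Crossing Joint → LinkLeg Crossing Joint
  arc_arc : ∀ x, arc (arc x) = x
  arc_ne : ∀ x, arc x ≠ x

attribute [instance] TangleDiagram.fintypeCrossing TangleDiagram.decEqCrossing
  TangleDiagram.fintypeJoint LinkDiagram.fintypeCrossing LinkDiagram.decEqCrossing
  LinkDiagram.fintypeJoint

/-- Diagrams of `n`-punctured ball tangles. -/
abbrev PBT (n : ℕ) := TangleDiagram (Fin n)

/-- Number of classes of the equivalence relation generated by `r`. -/
noncomputable def classCount {α : Type} (r : α → α → Prop) : ℕ := Nat.card (Quot r)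

/-- The next leg at the same vertex, counterclockwise on the oriented sphere.  The outside of the
big disc is a disc around the point at infinity, so there the order is reversed. -/
def Leg.rot {H C J : Type} : Leg H C J → Leg H C J
  | .outer j => .outer (j - 1)
  | .hole h j => .hole h (j + 1)
  | .crossing c j => .crossing c (j + 1)
  | .joint p s => .joint p (!s)

namespace TangleDiagram

variable {H : Type}

/-- The diagram can be drawn on the sphere (equivalently, in the big disc) with the prescribed
cyclic orders: every connected component of the combinatorial map has genus `0`, that is,
`V - E + F = 2 * (number of components)`. -/
def IsPlanar (T : TangleDiagram H) : Prop :=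
  (classCount (fun x y : Leg H T.Crossing T.Joint => y = x.rot) : ℤ)
      - classCount (fun x y : Leg H T.Crossing T.Joint => y = T.arc x)
      + classCount (fun x y : Leg H T.Crossing T.Joint => y = (T.arc x).rot)
    = 2 * classCount (fun x y : Leg H T.Crossing T.Joint => y = x.rot ∨ y = T.arc x)

/-! ### Filling holes -/

section fill

variable {K : H → Type} (T : TangleDiagram H) (B : ∀ h, TangleDiagram (K h))

/-- Joints of the filled diagram: the old ones, and the points `(h, j)` at which the boundary of
the hole `h` of `T` is glued to the outer boundary of `B h`. -/
abbrev FillJoint : Type := T.Joint ⊕ (Σ h, (B h).Joint) ⊕ (H × Fin 4)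

abbrev FillCrossing : Type := T.Crossing ⊕ (Σ h, (B h).Crossing)

/-- The legs of the filled diagram are the legs of `T` and of all the `B h`; the `j`-th boundary
point of the hole `h` and the `j`-th outer boundary point of `B h` become the two sides of one
joint. -/
def fillLegs :
    (Leg H T.Crossing T.Joint ⊕ Σ h, Leg (K h) (B h).Crossing (B h).Joint) ≃
      Leg (Σ h, K h) (FillCrossing T B) (FillJoint T B) where
  toFun
    | .inl (.outer j) => .outer j
    | .inl (.hole h j) => .joint (.inr (.inr (h, j))) false
    | .inl (.crossing c j) => .crossing (.inl c) j
    | .inl (.joint p s) => .joint (.inl p) s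
    | .inr ⟨h, .outer j⟩ => .joint (.inr (.inr (h, j))) true
    | .inr ⟨h, .hole k j⟩ => .hole ⟨h, k⟩ j
    | .inr ⟨h, .crossing c j⟩ => .crossing (.inr ⟨h, c⟩) j
    | .inr ⟨h, .joint p s⟩ => .joint (.inr (.inl ⟨h, p⟩)) s
  invFun
    | .outer j => .inl (.outer j)
    | .hole ⟨h, k⟩ j => .inr ⟨h, .hole k j⟩
    | .crossing (.inl c) j => .inl (.crossing c j)
    | .crossing (.inr ⟨h, c⟩) j => .inr ⟨h, .crossing c j⟩
    | .joint (.inl p) s => .inl (.joint p s)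
    | .joint (.inr (.inl ⟨h, p⟩)) s => .inr ⟨h, .joint p s⟩
    | .joint (.inr (.inr (h, j))) false => .inl (.hole h j)
    | .joint (.inr (.inr (h, j))) true => .inr ⟨h, .outer j⟩
  left_inv := by rintro ((_ | _ | _ | _) | ⟨_, (_ | _ | _ | _)⟩) <;> rfl
  right_inv := by
    rintro (_ | ⟨⟨_, _⟩, _⟩ | ⟨(_ | ⟨_, _⟩), _⟩ |
      ⟨(_ | (⟨_, _⟩ | ⟨_, _⟩)), (_ | _)⟩) <;> rfl

/-- The diagram `T(B)` obtained by putting `B h` into the hole `h` of `T`, for every `h`. -/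
def fill [Fintype H] [DecidableEq H] : TangleDiagram (Σ h, K h) where
  Crossing := FillCrossing T B
  Joint := FillJoint T B
  arc x := fillLegs T B
    (((fillLegs T B).symm x).map T.arc (Sigma.map id fun h => (B h).arc))
  arc_arc x := by
    obtain ⟨y, rfl⟩ := (fillLegs T B).surjective x
    rcases y with y | ⟨h, y⟩ <;> simp [Sigma.map, T.arc_arc, (B _).arc_arc]
  arc_ne x := by
    obtain ⟨y, rfl⟩ := (fillLegs T B).surjective x
    rcases y with y | ⟨h, y⟩ <;> simp [Sigma.map, T.arc_ne, (B _).arc_ne]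

end fill

/-- Renaming the holes. -/
def relabelLegs {H' C J : Type} (e : H ≃ H') : Leg H C J ≃ Leg H' C J where
  toFun
    | .outer j => .outer j
    | .hole h j => .hole (e h) j
    | .crossing c j => .crossing c j
    | .joint p s => .joint p s
  invFun
    | .outer j => .outer j
    | .hole h j => .hole (e.symm h) j
    | .crossing c j => .crossing c j
    | .joint p s => .joint p s
  left_inv := by rintro (_ | _ | _ | _) <;> simp
  right_inv := by rintro (_ | _ | _ | _) <;> simp

def relabel {H' : Type} (T : TangleDiagram H) (e : H ≃ H') : TangleDiagram H' where
  Crossing := T.Crossing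
  Joint := T.Joint
  arc x := relabelLegs e (T.arc ((relabelLegs e).symm x))
  arc_arc x := by simp [T.arc_arc]
  arc_ne x h := T.arc_ne ((relabelLegs e).symm x) (by
    rw [← (relabelLegs e).symm_apply_apply (T.arc _), h])

/-! ### Closures -/

/-- Gluing of the four outer boundary points in a closure.  Each of the two closing arcs carries
one joint.  Numerator (`r = 0`): arcs `NE-NW` and `SW-SE`; denominator (`r = 1`): arcs `NW-SW`
and `SE-NE`. -/
def closingArcs : Fin 2 → (Fin 4 ≃ Fin 2 × Bool)
  | 0 => ⟨![(0, false), (0, true), (1, false), (1, true)],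
      fun q => match q with
        | (0, false) => 0 | (0, true) => 1 | (1, false) => 2 | (1, true) => 3,
      by decide, by decide⟩
  | 1 => ⟨![(1, true), (0, false), (0, true), (1, false)],
      fun q => match q with
        | (0, false) => 1 | (0, true) => 2 | (1, false) => 3 | (1, true) => 0,
      by decide, by decide⟩

def closureLegs {C J : Type} [IsEmpty H] (r : Fin 2) :
    Leg H C J ≃ LinkLeg C (J ⊕ Fin 2) where
  toFun
    | .outer j => .joint (.inr (closingArcs r j).1) (closingArcs r j).2
    | .hole h _ => isEmptyElim h
    | .crossing c j => .crossing c j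
    | .joint p s => .joint (.inl p) s
  invFun
    | .crossing c j => .crossing c j
    | .joint (.inl p) s => .joint p s
    | .joint (.inr i) s => .outer ((closingArcs r).symm (i, s))
  left_inv := by
    rintro (_ | ⟨h, _⟩ | _ | _)
    · simp
    · exact isEmptyElim h
    · rfl
    · rfl
  right_inv := by rintro (_ | ⟨(_ | _), _⟩) <;> simp

/-- The numerator closure (`r = 0`) and the denominator closure (`r = 1`) of a ball tangle. -/
def closure [IsEmpty H] (B : TangleDiagram H) (r : Fin 2) : LinkDiagram where
  Crossing := B.Crossing
  Joint := B.Joint ⊕ Fin 2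
  arc x := closureLegs r (B.arc ((closureLegs r).symm x))
  arc_arc x := by simp [B.arc_arc]
  arc_ne x h := B.arc_ne ((closureLegs r).symm x) (by
    rw [← (closureLegs r).symm_apply_apply (B.arc _), h])

end TangleDiagram

/-! ### The Kauffman bracket -/

namespace LinkDiagram

variable (L : LinkDiagram)

/-- The leg to which `x` is connected inside its vertex, after the crossings have been split by
the state `σ` (`true` is the A-type splitting, which joins the two regions swept out by the
over-strand `1, 3` when it is turned counterclockwise, so it connects `0-1` and `2-3`; `false` is
the B-type splitting, connecting `0-3` and `1-2`). -/
def split (σ : L.Crossing → Bool) :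
    LinkLeg L.Crossing L.Joint → LinkLeg L.Crossing L.Joint
  | .crossing c j => .crossing c (if σ c then ![1, 0, 3, 2] j else ![3, 2, 1, 0] j)
  | .joint p s => .joint p (!s)

/-- Number of circles of the resolution of `L` by the state `σ`. -/
noncomputable def circles (σ : L.Crossing → Bool) : ℕ :=
  classCount (fun x y : LinkLeg L.Crossing L.Joint => y = L.arc x ∨ y = L.split σ x)

/-- The Kauffman bracket (for a link diagram that is not empty). -/
noncomputable def bracketAt (A : ℂ) : ℂ :=
  ∑ σ : L.Crossing → Bool,
    A ^ (Finset.univ.filter fun c => σ c = true).card *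
      A⁻¹ ^ (Finset.univ.filter fun c => σ c = false).card *
      (-A ^ 2 - A⁻¹ ^ 2) ^ (L.circles σ - 1)

/-- The Kauffman bracket at `A = exp (i π / 4)`. -/
noncomputable def bracket : ℂ := L.bracketAt (Complex.exp (Complex.I * Real.pi / 4))

end LinkDiagram

/-! ### The invariants -/

/-- The fundamental ball tangles without crossings: `0` is the tangle of the two vertical arcs
`NE-SE`, `NW-SW` (its numerator closure is one circle) and `1` is the tangle of the two
horizontal arcs `NE-NW`, `SE-SW` (its denominator closure is one circle). -/
def fundamental (a : Fin 2) : PBT 0 where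
  Crossing := Empty
  Joint := Empty
  arc
    | .outer j => .outer (if a = 0 then ![3, 2, 1, 0] j else ![1, 0, 3, 2] j)
    | x => x
  arc_arc := by
    rintro (j | ⟨h, _⟩ | ⟨c, _⟩ | ⟨p, _⟩)
    · fin_cases a <;> fin_cases j <;> rfl
    · exact h.elim0
    · exact c.elim
    · exact p.elim
  arc_ne := by
    rintro (j | ⟨h, _⟩ | ⟨c, _⟩ | ⟨p, _⟩)
    · fin_cases a <;> fin_cases j <;> simp
    · exact h.elim0
    · exact c.elim
    · exact p.elim

/-- The link diagram obtained from an `n`-punctured ball tangle diagram by putting the fundamental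
tangle `α i` into the `i`-th hole and taking the closure `r`. -/
def PBT.close {n : ℕ} (T : PBT n) (r : Fin 2) (α : Fin n → Fin 2) : LinkDiagram :=
  haveI : IsEmpty (Σ _ : Fin n, Fin 0) := ⟨fun x => x.2.elim0⟩
  (T.fill fun i => fundamental (α i)).closure r

/-- The `k`-th element of `{0,1}ⁿ` in the dictionary order (the first coordinate is the most
significant digit of `k` in base 2). -/
def dict (n : ℕ) (k : Fin (2 ^ n)) : Fin n → Fin 2 := fun j => finFunctionFinEquiv.symm k j.rev

/-- The exponent of `-i` in the `k`-th column: the number of holes that are filled with the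
horizontal fundamental tangle. -/
def expo (n : ℕ) (k : Fin (2 ^ n)) : ℕ := (Finset.univ.filter fun j => dict n k j = 1).card

/-- The class of `M` modulo the scalar multiplication by `±1`, as a set of matrices. -/
def pmClass {m n : Type} (M : Matrix m n ℤ) : Set (Matrix m n ℤ) := {M, -M}

/-- The invariant `f` of ball tangle diagrams: the integral columns among
`(z ⟨B₁⟩, i z ⟨B₂⟩)` with `z ^ 8 = 1`. -/
def f (B : PBT 0) : Set (Matrix (Fin 2) (Fin 1) ℤ) :=
  {N | ∃ z : ℂ, z ^ 8 = 1 ∧ N.map (Int.cast : ℤ → ℂ) =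
    !![z * (B.closure 0).bracket; Complex.I * z * (B.closure 1).bracket]}

/-- The invariant `Fⁿ` of `n`-punctured ball tangle diagrams. -/
def F {n : ℕ} (T : PBT n) : Set (Matrix (Fin 2) (Fin (2 ^ n)) ℤ) :=
  {N | ∃ z : ℂ, z ^ 8 = 1 ∧ N.map (Int.cast : ℤ → ℂ) =
    Matrix.of fun (r : Fin 2) (k : Fin (2 ^ n)) =>
      (-Complex.I) ^ expo n k * Complex.I ^ (r : ℕ) * z * (T.close r (dict n k)).bracket}

/-! ### The tangles of the theorem -/

/-- The spherical tangle `I`: the outer boundary points are joined radially to those of the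
hole. -/
def sphericalId : PBT 1 where
  Crossing := Empty
  Joint := Empty
  arc
    | .outer j => .hole 0 j
    | .hole _ j => .outer j
    | x => x
  arc_arc := by
    rintro (_ | ⟨h, _⟩ | ⟨c, _⟩ | ⟨p, _⟩)
    · rfl
    · rw [Subsingleton.elim h 0]
    · exact c.elim
    · exact p.elim
  arc_ne := by
    rintro (_ | _ | ⟨c, _⟩ | ⟨p, _⟩)
    · simp
    · simp
    · exact c.elim
    · exact p.elim

/-- The 5-punctured ball tangle without crossings whose holes `0, 1, 2, 3` lie at the corners
NW, NE, SW, SE of a square with the hole `4` in its centre.  Each corner hole is joined by one arc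
to the outer boundary, by one arc to the central hole and by one arc to each of the two
corner holes next to it. -/
def T5 : PBT 5 where
  Crossing := Empty
  Joint := Empty
  arc
    | .outer 0 => .hole 1 0
    | .outer 1 => .hole 0 1
    | .outer 2 => .hole 2 2
    | .outer 3 => .hole 3 3
    | .hole 0 0 => .hole 1 1
    | .hole 0 1 => .outer 1
    | .hole 0 2 => .hole 2 1
    | .hole 0 3 => .hole 4 1
    | .hole 1 0 => .outer 0
    | .hole 1 1 => .hole 0 0
    | .hole 1 2 => .hole 4 0
    | .hole 1 3 => .hole 3 0
    | .hole 2 0 => .hole 4 2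
    | .hole 2 1 => .hole 0 2
    | .hole 2 2 => .outer 2
    | .hole 2 3 => .hole 3 2
    | .hole 3 0 => .hole 1 3
    | .hole 3 1 => .hole 4 3
    | .hole 3 2 => .hole 2 3
    | .hole 3 3 => .outer 3
    | .hole 4 0 => .hole 1 2
    | .hole 4 1 => .hole 0 3
    | .hole 4 2 => .hole 2 0
    | .hole 4 3 => .hole 3 1
    | x => x
  arc_arc := by
    rintro (j | ⟨h, j⟩ | ⟨c, _⟩ | ⟨p, _⟩)
    · fin_cases j <;> rfl
    · fin_cases h <;> fin_cases j <;> rfl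
    · exact c.elim
    · exact p.elim
  arc_ne := by
    rintro (j | ⟨h, j⟩ | ⟨c, _⟩ | ⟨p, _⟩)
    · fin_cases j <;> simp
    · fin_cases h <;> fin_cases j <;> simp
    · exact c.elim
    · exact p.elim

/-- Numbers of holes of the five tangles put into `T5`. -/
def arity : Fin 5 → ℕ := ![0, 0, 0, 0, 1]

/-- The five tangles `B 0, B 1, B 2, B 3, I`. -/
def fillers (B : Fin 4 → PBT 0) : ∀ i : Fin 5, PBT (arity i)
  | 0 => B 0
  | 1 => B 1
  | 2 => B 2
  | 3 => B 3
  | 4 => sphericalId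

/-- The spherical tangle `X = T⁵(B⁽¹⁾, B⁽²⁾, B⁽³⁾, B⁽⁴⁾, I)`. -/
def X (B : Fin 4 → PBT 0) : PBT 1 :=
  (T5.fill (fillers B)).relabel (finSigmaFinEquiv.trans (finCongr (by decide)))

end PunctTangle

namespace PunctTangle

/-! At A = exp(iπ/4) the loop value -A² - A⁻² is zero, so only states whose resolution is a single
circle contribute to a bracket (`LinkDiagram.bracket_eq_sum`). The whole argument therefore counts
connected states, and connectedness is tested dually: a resolution is connected when every
two-valued function constant along its strands is constant. Such functions restrict to pieces and
glue along boundary points, which makes filling holes easy to handle.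

Planarity enters through one fact: a resolved ball tangle cannot join opposite ends, so it pairs its
ends like one of the two fundamental tangles (`TangleDiagram.IsPlanar.exists_sameStrand_iff`). To
prove it, genus 0 is turned into a checkerboard colouring by a dimension count over `ZMod 2`; the
colouring makes the alternating sum of the boundary values of an invariant function vanish, and the
indicator of a strand then has as many even as odd ends. Consequently the closure `r` of a state is
connected exactly when the state has type `r` and no closed component
(`TangleDiagram.IsPlanar.isConnectedState_closure_iff`), so ⟨B₁⟩ and ⟨B₂⟩ are the weighted counts of
states of the two types.

A state of a closure of `X` is a quadruple of states of the pieces. It is connected exactly when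
each piece has a type and the four types, put into `T5`, give one circle; the admissible quadruples
are found by a finite check (`T5.circle_spec`). Types are unique, so each bracket of `X` is a sum,
over admissible quadruples, of products of brackets of the pieces (`bracket_close_X`). Choosing
roots of unity for the four pieces turns these sums into the stated integers. Two nonzero integral
multiples of one matrix by eighth roots of unity differ only by sign, so this matrix determines the
class. The determinant is then a polynomial identity. -/

/-- The leg of a crossing to which the leg `j` is joined by the splitting `b`. -/
def splitIndex (b : Bool) (j : Fin 4) : Fin 4 :=
  if b then ![1, 0, 3, 2] j else ![3, 2, 1, 0] j

/-- The end to which the end `j` of the fundamental tangle `a` is joined. -/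
def fundamentalIndex (a : Fin 2) (j : Fin 4) : Fin 4 :=
  if a = 0 then ![3, 2, 1, 0] j else ![1, 0, 3, 2] j

/-- The end to which the end `j` of a ball tangle is joined in the closure `r`. -/
def closureIndex (r : Fin 2) (j : Fin 4) : Fin 4 :=
  if r = 0 then ![1, 0, 3, 2] j else ![3, 2, 1, 0] j

lemma splitIndex_splitIndex (b : Bool) (j : Fin 4) : splitIndex b (splitIndex b j) = j := by
  revert b j; decide

/-! ### Functions constant along strands -/

namespace TangleDiagram

variable {H V : Type}

/-- `g` is constant along the strands of the resolution of `T` by the state `σ`. -/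
structure IsInvariant (T : TangleDiagram H) (σ : T.Crossing → Bool)
    (g : Leg H T.Crossing T.Joint → V) : Prop where
  arc : ∀ x, g (T.arc x) = g x
  crossing : ∀ c j, g (.crossing c (splitIndex (σ c) j)) = g (.crossing c j)
  joint : ∀ p s, g (.joint p (!s)) = g (.joint p s)

lemma IsInvariant.const (T : TangleDiagram H) (σ : T.Crossing → Bool) (v : V) :
    T.IsInvariant σ fun _ => v :=
  ⟨fun _ => rfl, fun _ _ => rfl, fun _ _ => rfl⟩

/-- Gluing introduces no new strand segments, only joints at the boundary points of the holes; those
joints are the source of the third condition. -/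
lemma isInvariant_fill_iff [Fintype H] [DecidableEq H] {K : H → Type} (T : TangleDiagram H)
    (B : ∀ h, TangleDiagram (K h)) (σ : (T.fill B).Crossing → Bool)
    (g : Leg (Σ h, K h) (T.fill B).Crossing (T.fill B).Joint → V) :
    (T.fill B).IsInvariant σ g ↔
      T.IsInvariant (fun c => σ (.inl c)) (fun x => g (fillLegs T B (.inl x))) ∧
      (∀ h, (B h).IsInvariant (fun c => σ (.inr ⟨h, c⟩))
        (fun x => g (fillLegs T B (.inr ⟨h, x⟩)))) ∧
      ∀ h j, g (fillLegs T B (.inr ⟨h, .outer j⟩)) = g (fillLegs T B (.inl (.hole h j))) := by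
  constructor
  · rintro ⟨ha, hc, hj⟩
    refine ⟨⟨fun x => ?_, fun c j => hc (.inl c) j, fun p s => hj (.inl p) s⟩, fun h =>
      ⟨fun x => ?_, fun c j => hc (.inr ⟨h, c⟩) j, fun p s => hj (.inr (.inl ⟨h, p⟩)) s⟩,
      fun h j => hj (.inr (.inr (h, j))) false⟩
    · simpa [fill] using ha (fillLegs T B (.inl x))
    · simpa [fill, Sigma.map] using ha (fillLegs T B (.inr ⟨h, x⟩))
  · rintro ⟨hT, hB, hg⟩
    refine ⟨fun x => ?_, ?_, ?_⟩
    · obtain ⟨y, rfl⟩ := (fillLegs T B).surjective x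
      rcases y with y | ⟨h, y⟩
      · simpa [fill] using hT.arc y
      · simpa [fill, Sigma.map] using (hB h).arc y
    · rintro (c | ⟨h, c⟩) j
      · exact hT.crossing c j
      · exact (hB h).crossing c j
    · rintro (p | ⟨h, p⟩ | ⟨h, j⟩) s
      · exact hT.joint p s
      · exact (hB h).joint p s
      · cases s
        · exact hg h j
        · exact (hg h j).symm

lemma isInvariant_relabel_iff {H' : Type} (T : TangleDiagram H) (e : H ≃ H')
    (σ : T.Crossing → Bool) (g : Leg H' T.Crossing T.Joint → V) :
    (T.relabel e).IsInvariant σ g ↔ T.IsInvariant σ fun x => g (relabelLegs e x) := by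
  constructor
  · rintro ⟨ha, hc, hj⟩
    refine ⟨fun x => ?_, hc, hj⟩
    have h := ha (relabelLegs e x)
    change g (relabelLegs e (T.arc ((relabelLegs e).symm (relabelLegs e x)))) = _ at h
    rwa [Equiv.symm_apply_apply] at h
  · rintro ⟨ha, hc, hj⟩
    refine ⟨fun x => ?_, hc, hj⟩
    have h := ha ((relabelLegs e).symm x)
    exact h.trans (congrArg g ((relabelLegs e).apply_symm_apply x))

end TangleDiagram

/-! ### The bracket as a sum over single-circle states -/

namespace LinkDiagram

/-- The resolution of `L` by the state `σ` has at most one circle. -/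
def IsConnectedState (L : LinkDiagram) (σ : L.Crossing → Bool) : Prop :=
  ∀ g : LinkLeg L.Crossing L.Joint → Bool, (∀ x, g (L.arc x) = g x) →
    (∀ x, g (L.split σ x) = g x) → ∀ x y, g x = g y

end LinkDiagram

instance {C J : Type} [Finite C] [Finite J] : Finite (LinkLeg C J) :=
  Finite.of_injective (β := (C × Fin 4) ⊕ (J × Bool))
    (fun | .crossing c j => .inl (c, j) | .joint p s => .inr (p, s))
    (by rintro (_ | _) (_ | _) <;> simp)

instance {H C J : Type} [Finite H] [Finite C] [Finite J] : Finite (Leg H C J) :=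
  Finite.of_injective (β := Fin 4 ⊕ (H × Fin 4) ⊕ (C × Fin 4) ⊕ (J × Bool))
    (fun | .outer j => .inl j | .hole h j => .inr (.inl (h, j))
         | .crossing c j => .inr (.inr (.inl (c, j))) | .joint p s => .inr (.inr (.inr (p, s))))
    (by rintro (_ | _ | _ | _) (_ | _ | _ | _) <;> simp)

namespace LinkDiagram

/-- If there are two circles, the indicator of one of them is a non-constant invariant function.
Subtraction is truncated, hence "at most one" rather than "exactly one". -/
lemma circles_sub_one_eq_zero_iff (L : LinkDiagram) (σ : L.Crossing → Bool) :
    L.circles σ - 1 = 0 ↔ L.IsConnectedState σ := by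
  have : L.circles σ - 1 = 0 ↔ Subsingleton
      (Quot fun x y : LinkLeg L.Crossing L.Joint => y = L.arc x ∨ y = L.split σ x) := by
    rw [← Finite.card_le_one_iff_subsingleton, circles, classCount]; omega
  rw [this]
  constructor
  · intro h g ha hs x y
    have hr : ∀ a b, b = L.arc a ∨ b = L.split σ a → g a = g b := by
      rintro a b (rfl | rfl)
      exacts [(ha a).symm, (hs a).symm]
    exact congrArg (Quot.lift g hr) (Subsingleton.elim (Quot.mk _ x) (Quot.mk _ y))
  · intro h
    constructor
    rintro ⟨x⟩ ⟨y⟩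
    classical
    let R := fun x y : LinkLeg L.Crossing L.Joint => y = L.arc x ∨ y = L.split σ x
    have h1 : ∀ z, Quot.mk R (L.arc z) = Quot.mk R z := fun z => (Quot.sound (r := R) (Or.inl rfl)).symm
    have h2 : ∀ z, Quot.mk R (L.split σ z) = Quot.mk R z :=
      fun z => (Quot.sound (r := R) (Or.inr rfl)).symm
    have := h (fun z => decide (Quot.mk R x = Quot.mk R z))
      (fun z => by rw [h1]) (fun z => by rw [h2]) x y
    simpa using this

end LinkDiagram

/-- The value of the variable of the bracket polynomial. -/
noncomputable def rootA : ℂ := Complex.exp (Complex.I * Real.pi / 4)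

/-- The weight of a splitting. -/
noncomputable def splitWeight (b : Bool) : ℂ := if b then rootA else rootA⁻¹

lemma rootA_loop : -rootA ^ 2 - rootA⁻¹ ^ 2 = 0 := by
  have h : rootA ^ 2 = Complex.I := by
    rw [rootA, ← Complex.exp_nat_mul]
    rw [show ((2 : ℕ) : ℂ) * (Complex.I * Real.pi / 4) = Real.pi / 2 * Complex.I by
      push_cast; ring]
    exact Complex.exp_pi_div_two_mul_I
  rw [inv_pow, h]; simp

-- The loop value is 0 and `0 ^ 0 = 1`, so a state contributes its weight when connected and nothing
-- otherwise. Writing the weight as a product over crossings lets it factor over the pieces of a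
-- filled diagram.
open Classical in
lemma LinkDiagram.bracket_eq_sum (L : LinkDiagram) :
    L.bracket = ∑ σ : L.Crossing → Bool,
      if L.IsConnectedState σ then ∏ c, splitWeight (σ c) else 0 := by
  rw [bracket, bracketAt]
  refine Finset.sum_congr rfl fun σ _ => ?_
  change rootA ^ _ * rootA⁻¹ ^ _ * (-rootA ^ 2 - rootA⁻¹ ^ 2) ^ _ = _
  rw [rootA_loop]
  have hp : ∏ c, splitWeight (σ c) =
      rootA ^ (Finset.univ.filter fun c => σ c = true).card *
        rootA⁻¹ ^ (Finset.univ.filter fun c => σ c = false).card := by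
    simp only [splitWeight, Finset.prod_ite, Finset.prod_const]
    simp
  split_ifs with h
  · rw [(L.circles_sub_one_eq_zero_iff σ).2 h, hp]; simp
  · rw [zero_pow (mt (L.circles_sub_one_eq_zero_iff σ).1 h), mul_zero]

namespace TangleDiagram

variable {H : Type}

/-- The two joints on the closing arcs impose just one extra condition, that ends joined by a
closing arc have equal values. Connectedness of a link thus becomes a statement about the tangle
alone. -/
lemma isConnectedState_closure_iff [IsEmpty H] (B : TangleDiagram H) (r : Fin 2)
    (σ : B.Crossing → Bool) :
    (B.closure r).IsConnectedState σ ↔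
      ∀ g : Leg H B.Crossing B.Joint → Bool, B.IsInvariant σ g →
        (∀ j, g (.outer (closureIndex r j)) = g (.outer j)) → ∀ x y, g x = g y := by
  let e : Leg H B.Crossing B.Joint ≃ LinkLeg B.Crossing (B.Joint ⊕ Fin 2) := closureLegs r
  let sp : LinkLeg B.Crossing (B.Joint ⊕ Fin 2) → LinkLeg B.Crossing (B.Joint ⊕ Fin 2) :=
    (B.closure r).split σ
  have key : ∀ j, sp (e (.outer j)) = e (.outer (closureIndex r j)) := by
    intro j
    have : closureIndex r j = (closingArcs r).symm
      ((closingArcs r j).1, !(closingArcs r j).2) := by revert r j; decide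
    have h : e (e.symm (sp (e (.outer j)))) = e (.outer (closureIndex r j)) := by
      rw [this]; rfl
    rwa [Equiv.apply_symm_apply] at h
  constructor
  · intro h g hg hj x y
    have h' := h (fun z => g (e.symm z))
      (fun z => (congrArg g (e.symm_apply_apply _)).trans (hg.arc (e.symm z)))
      (fun z => ?_) (e x) (e y)
    · simpa only [Equiv.symm_apply_apply] using h'
    · change g (e.symm (sp z)) = g (e.symm z)
      obtain ⟨y, rfl⟩ := e.surjective z
      rcases y with j | ⟨h, _⟩ | ⟨c, j⟩ | ⟨p, s⟩
      · rw [key, e.symm_apply_apply, e.symm_apply_apply, hj]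
      · exact isEmptyElim h
      · exact hg.crossing c j
      · exact hg.joint p s
  · intro h g ha hs x y
    have h' := h (fun z => g (e z)) ⟨fun z => ?_, fun c j => hs (.crossing c j),
      fun p s => hs (.joint (.inl p) s)⟩ (fun j => ?_) (e.symm x) (e.symm y)
    · exact ((congrArg g (e.apply_symm_apply x)).symm.trans h').trans
        (congrArg g (e.apply_symm_apply y))
    · exact (congrArg (fun w => g (e (B.arc w))) (e.symm_apply_apply z)).symm.trans (ha (e z))
    · rw [← key]; exact hs _

end TangleDiagram
-- Checkerboard colourings from genus 0
section Colouring

variable {D : Type}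

lemma eq_or_eq_of_quot_mk_eq {a : D → D} (ha : ∀ x, a (a x) = x) {x y : D}
    (h : Quot.mk (fun x y => y = a x) x = Quot.mk (fun x y => y = a x) y) :
    x = y ∨ x = a y := by
  have hs : ∀ u v, v = a u → ({u, a u} : Set D) = {v, a v} := by
    rintro u v rfl; rw [ha, Set.pair_comm]
  have h' : ({x, a x} : Set D) = {y, a y} := congrArg (Quot.lift _ hs) h
  have : x ∈ ({y, a y} : Set D) := h' ▸ Set.mem_insert _ _
  simpa using this

lemma quot_out_eq_or {a : D → D} (ha : ∀ x, a (a x) = x) (x : D) :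
    (Quot.mk (fun x y => y = a x) x).out = x ∨ (Quot.mk (fun x y => y = a x) x).out = a x :=
  eq_or_eq_of_quot_mk_eq ha (Quot.out_eq _)

-- Each edge consists of exactly two legs, since the involution has no fixed point.
open Classical in
lemma sum_quot_out [Fintype D] {a : D → D} (ha : ∀ x, a (a x) = x) (hne : ∀ x, a x ≠ x)
    [Fintype (Quot fun x y => y = a x)] (φ : D → ZMod 2) :
    ∑ e : Quot fun x y => y = a x, (φ e.out + φ (a e.out)) = ∑ x, φ x := by
  rw [← Finset.sum_fiberwise (s := Finset.univ) (g := Quot.mk fun x y => y = a x)]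
  refine Finset.sum_congr rfl fun e _ => ?_
  have : (Finset.univ.filter fun x => Quot.mk (fun x y => y = a x) x = e) =
      {e.out, a e.out} := by
    ext x
    simp only [Finset.mem_filter, Finset.mem_univ, true_and, Finset.mem_insert,
      Finset.mem_singleton]
    constructor
    · intro h; exact eq_or_eq_of_quot_mk_eq ha (h.trans (Quot.out_eq e).symm)
    · rintro (h | h)
      · rw [h, Quot.out_eq]
      · rw [h]
        have h3 : Quot.mk (fun x y => y = a x) e.out = Quot.mk _ (a e.out) := Quot.sound rfl
        rw [← h3, Quot.out_eq]
  rw [this, Finset.sum_pair (hne _).symm]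

variable (a : D → D) (r : D → D → Prop)

/-- The coboundary from the functions on the classes of `r` to the functions on the edges
`{x, a x}`. -/
noncomputable def edgeCoboundary :
    (Quot r → ZMod 2) →ₗ[ZMod 2] ((Quot fun x y => y = a x) → ZMod 2) :=
  LinearMap.funLeft (ZMod 2) (ZMod 2) (fun e => Quot.mk r e.out) +
    LinearMap.funLeft (ZMod 2) (ZMod 2) (fun e => Quot.mk r (a e.out))

variable {a r}

lemma edgeCoboundary_mk (ha : ∀ x, a (a x) = x) (u : Quot r → ZMod 2) (x : D) :
    edgeCoboundary a r u (Quot.mk _ x) = u (Quot.mk r x) + u (Quot.mk r (a x)) := by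
  rcases quot_out_eq_or ha x with h | h <;> simp [edgeCoboundary, LinearMap.funLeft, h, ha, add_comm]

/-- Rank and nullity: a function in the kernel takes equal values at both ends of each edge, hence
descends to the classes of `rc`, the connected components in the application. -/
lemma card_le_finrank_range_edgeCoboundary [Finite D] (ha : ∀ x, a (a x) = x)
    (rc : D → D → Prop) (hrc : ∀ x y, rc x y → r x y ∨ y = a x) (hr : ∀ x y, r x y → rc x y) :
    Nat.card (Quot r) ≤ Module.finrank (ZMod 2) (LinearMap.range (edgeCoboundary a r)) +
      Nat.card (Quot rc) := by
  classical
  have := Fintype.ofFinite (Quot r)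
  have := Fintype.ofFinite (Quot rc)
  have h1 := LinearMap.finrank_range_add_finrank_ker (edgeCoboundary a r)
  rw [Module.finrank_fintype_fun_eq_card, ← Nat.card_eq_fintype_card] at h1
  let π : Quot r → Quot rc := Quot.map id hr
  have h2 : LinearMap.ker (edgeCoboundary a r) ≤
      LinearMap.range (LinearMap.funLeft (ZMod 2) (ZMod 2) π) := by
    intro u hu
    have hu' : ∀ x, u (Quot.mk r x) = u (Quot.mk r (a x)) := by
      intro x
      have := edgeCoboundary_mk ha u x
      rw [LinearMap.mem_ker.1 hu] at this
      exact CharTwo.add_eq_zero.1 this.symm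
    refine ⟨Quot.lift (fun x => u (Quot.mk r x)) fun x y hxy => ?_, ?_⟩
    · rcases hrc x y hxy with h | rfl
      · rw [Quot.sound h]
      · exact hu' x
    · ext ⟨x⟩; rfl
  have h3 := Submodule.finrank_mono h2
  have h4 := LinearMap.finrank_range_le (LinearMap.funLeft (ZMod 2) (ZMod 2) π)
  rw [Module.finrank_fintype_fun_eq_card, ← Nat.card_eq_fintype_card] at h4
  omega

/-- This is the vanishing of the first homology of the sphere with coefficients in `ZMod 2`. The
edge functions coming from vertices and those coming from faces are orthogonal, and Euler's formula
makes them orthogonal complements. Vertices of even degree make the constant 1 orthogonal to the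
vertex functions, so it is the coboundary of a function on the faces: a colouring that changes
across every edge. -/
lemma exists_checkerboard [Finite D] {rot : D → D} (hrot : rot.Bijective)
    (ha : ∀ x, a (a x) = x) (hne : ∀ x, a x ≠ x)
    (heven : ∀ [Fintype D] (u : D → ZMod 2), (∀ x, u (rot x) = u x) → ∑ x, u x = 0)
    (hgenus : (classCount (fun x y => y = rot x) : ℤ) - classCount (fun x y => y = a x)
      + classCount (fun x y => y = rot (a x))
      = 2 * classCount fun x y => y = rot x ∨ y = a x) :
    ∃ c : D → ZMod 2, (∀ x, c (rot x) = c x + 1) ∧ ∀ x, c (a x) = c x + 1 := by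
  classical
  have := Fintype.ofFinite D
  have := Fintype.ofFinite (Quot fun x y => y = a x)
  let rV := fun x y => y = rot x
  let rF := fun x y => y = rot (a x)
  have hV := card_le_finrank_range_edgeCoboundary (r := rV) ha (fun x y => y = rot x ∨ y = a x)
    (fun x y h => h) (fun x y h => Or.inl h)
  -- Vertices and edges generate the same components as faces and edges, so the same number of
  -- components appears in both rank bounds.
  have hF' : Nat.card (Quot fun x y => y = rot x ∨ y = a x) =
      Nat.card (Quot fun x y => y = rot (a x) ∨ y = a x) := by
    refine Nat.card_congr (Equiv.ofBijective (Quot.lift (fun x => Quot.mk _ x) ?_)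
      (Function.bijective_iff_has_inverse.2 ⟨Quot.lift (fun x => Quot.mk _ x) ?_, ?_, ?_⟩))
    · rintro x y (rfl | rfl)
      · have h1 : Quot.mk (fun x y => y = rot (a x) ∨ y = a x) (a x) = Quot.mk _ (rot x) :=
          Quot.sound (Or.inl (by rw [ha]))
        rw [← h1]; exact Quot.sound (Or.inr rfl)
      · exact Quot.sound (Or.inr rfl)
    · rintro x y (rfl | rfl)
      · have h1 : Quot.mk (fun x y => y = rot x ∨ y = a x) (a x) = Quot.mk _ (rot (a x)) :=
          Quot.sound (Or.inl rfl)
        rw [← h1]; exact Quot.sound (Or.inr rfl)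
      · exact Quot.sound (Or.inr rfl)
    · rintro ⟨x⟩; rfl
    · rintro ⟨x⟩; rfl
  have hF := card_le_finrank_range_edgeCoboundary (r := rF) ha
    (fun x y => y = rot (a x) ∨ y = a x) (fun x y h => h) (fun x y h => Or.inl h)
  let Bf : LinearMap.BilinForm (ZMod 2) ((Quot fun x y => y = a x) → ZMod 2) :=
    Matrix.toBilin' 1
  have hBf : ∀ v w, Bf v w = ∑ e, v e * w e := by
    intro v w; simp [Bf, Matrix.toBilin'_apply', dotProduct]
  have hnd : Bf.Nondegenerate :=
    LinearMap.BilinForm.nondegenerate_toBilin'_of_det_ne_zero' 1 (by simp)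
  -- The pairing over edges is rewritten as a sum over legs, where the vertex rotation can be used
  -- to reindex.
  have horth : ∀ (u : Quot rV → ZMod 2) (k : D → ZMod 2),
      (∑ x, u (Quot.mk _ x) * k x = 0) → ∀ w : (Quot fun x y => y = a x) → ZMod 2,
      (∀ x, w (Quot.mk _ x) = k x) → Bf (edgeCoboundary a rV u) w = 0 := by
    intro u k h w hw
    rw [hBf, ← h, ← sum_quot_out ha hne]
    refine Finset.sum_congr rfl fun e _ => ?_
    have h1 : Quot.mk (fun x y => y = a x) (a e.out) = e := by
      have h3 : Quot.mk (fun x y => y = a x) e.out = Quot.mk _ (a e.out) := Quot.sound rfl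
      rw [← h3, Quot.out_eq]
    rw [← hw, ← hw, h1, Quot.out_eq, ← add_mul]
    rfl
  have hle : LinearMap.range (edgeCoboundary a rF) ≤
      Bf.orthogonal (LinearMap.range (edgeCoboundary a rV)) := by
    rintro _ ⟨g, rfl⟩
    rw [LinearMap.BilinForm.mem_orthogonal_iff]
    rintro _ ⟨u, rfl⟩
    refine horth u (fun x => g (Quot.mk _ x) + g (Quot.mk _ (a x))) ?_ _ (edgeCoboundary_mk ha g)
    have h1 : ∀ x, g (Quot.mk _ (a x)) = g (Quot.mk _ (rot x)) := fun x => by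
      rw [Quot.sound (r := rF) (show rF (a x) (rot x) by simp only [rF, ha])]
    have h2 : ∀ x, u (Quot.mk _ x) = u (Quot.mk _ (rot x)) := fun x => by
      rw [Quot.sound (r := rV) (show rV x (rot x) from rfl)]
    have h3 : ∀ x, u (Quot.mk _ x) * (g (Quot.mk _ x) + g (Quot.mk _ (a x))) =
        u (Quot.mk _ x) * g (Quot.mk _ x) + u (Quot.mk _ (rot x)) * g (Quot.mk _ (rot x)) := by
      intro x; rw [h1, ← h2, mul_add]
    simp only [h3, Finset.sum_add_distrib]
    rw [hrot.sum_comp (fun x => u (Quot.mk _ x) * g (Quot.mk _ x))]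
    exact CharTwo.add_self_eq_zero _
  have hdim := LinearMap.BilinForm.finrank_orthogonal hnd
    (LinearMap.range (edgeCoboundary a rV))
  have hE : Module.finrank (ZMod 2) ((Quot fun x y => y = a x) → ZMod 2) =
      Nat.card (Quot fun x y => y = a x) := by
    rw [Module.finrank_fintype_fun_eq_card, Nat.card_eq_fintype_card]
  -- With V, E, F, C the numbers of vertices, edges, faces and components, the orthogonal complement
  -- has dimension at most E - V + C = F - C, which is at most the rank of the face coboundary.
  have heq : LinearMap.range (edgeCoboundary a rF) =
      Bf.orthogonal (LinearMap.range (edgeCoboundary a rV)) := by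
    refine Submodule.eq_of_le_of_finrank_le hle ?_
    rw [hdim, hE]
    simp only [classCount] at hgenus
    simp only [rV, rF] at *
    omega
  have h1 : (fun _ => 1) ∈ LinearMap.range (edgeCoboundary a rF) := by
    rw [heq, LinearMap.BilinForm.mem_orthogonal_iff]
    rintro _ ⟨u, rfl⟩
    refine horth u (fun _ => 1) ?_ _ fun _ => rfl
    simp only [mul_one]
    refine heven _ fun x => ?_
    rw [Quot.sound (r := rV) (show rV x (rot x) from rfl)]
  obtain ⟨g, hg⟩ := h1
  have hga : ∀ x, g (Quot.mk _ x) + g (Quot.mk _ (a x)) = 1 := fun x => by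
    rw [← edgeCoboundary_mk ha, hg]
  have hc : ∀ x, g (Quot.mk _ (a x)) = g (Quot.mk _ x) + 1 := fun x => by
    have := hga x
    rw [← this, ← add_assoc, CharTwo.add_self_eq_zero, zero_add]
  refine ⟨fun x => g (Quot.mk _ x), fun x => ?_, hc⟩
  change g (Quot.mk _ (rot x)) = g (Quot.mk _ x) + 1
  rw [← hc x, ← Quot.sound (r := rF) (show rF (a x) (rot x) by simp only [rF, ha])]

end Colouring

lemma Leg.rot_bijective {H C J : Type} : (Leg.rot : Leg H C J → Leg H C J).Bijective := by
  refine Function.bijective_iff_has_inverse.2 ⟨fun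
    | .outer j => .outer (j + 1)
    | .hole h j => .hole h (j - 1)
    | .crossing c j => .crossing c (j - 1)
    | .joint p s => .joint p (!s), ?_, ?_⟩ <;> rintro (_ | _ | _ | _) <;> simp [Leg.rot]

/-- The opposite leg at a vertex. -/
def Leg.opposite {H C J : Type} : Leg H C J → Leg H C J
  | .outer j => .outer (j + 2)
  | .hole h j => .hole h (j + 2)
  | .crossing c j => .crossing c (j + 2)
  | .joint p s => .joint p (!s)

/-- Every vertex has degree 4 or 2, so passing to the opposite leg pairs the terms and they cancel
modulo 2. -/
lemma Leg.sum_eq_zero {H C J : Type} [Fintype (Leg H C J)] (u : Leg H C J → ZMod 2)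
    (hu : ∀ x, u x.rot = u x) : ∑ x, u x = 0 := by
  have h4 : ∀ j : Fin 4, j + 2 + 2 = j := by decide
  have hne : ∀ j : Fin 4, j + 2 ≠ j := by decide
  refine Finset.sum_involution (fun x _ => x.opposite) (fun x _ => ?_) (fun x _ _ => ?_)
    (fun _ _ => Finset.mem_univ _) (fun x _ => ?_)
  · have : u x.opposite = u x := by
      rcases x with j | ⟨h, j⟩ | ⟨c, j⟩ | ⟨p, s⟩
      · have h1 := hu (.outer j)
        have h2 := hu (.outer (j - 1))
        have h3 : ∀ j : Fin 4, j - 1 - 1 = j + 2 := by decide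
        simp only [Leg.rot, h3] at h1 h2
        exact h2.trans h1
      · have h1 := hu (.hole h j)
        have h2 := hu (.hole h (j + 1))
        simp only [Leg.rot, add_assoc] at h1 h2
        exact h2.trans h1
      · have h1 := hu (.crossing c j)
        have h2 := hu (.crossing c (j + 1))
        simp only [Leg.rot, add_assoc] at h1 h2
        exact h2.trans h1
      · exact hu (.joint p s)
    rw [this]; exact CharTwo.add_self_eq_zero _
  · rcases x with j | ⟨h, j⟩ | ⟨c, j⟩ | ⟨p, s⟩ <;> simp [Leg.opposite, hne]
  · rcases x with j | ⟨h, j⟩ | ⟨c, j⟩ | ⟨p, s⟩ <;> simp [Leg.opposite, h4]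

/-- A planar diagram has a checkerboard colouring: around every vertex and along every strand
segment the colours of the corners alternate. -/
lemma TangleDiagram.IsPlanar.exists_checkerboard {H : Type} [Finite H] {T : TangleDiagram H}
    (hT : T.IsPlanar) :
    ∃ c : Leg H T.Crossing T.Joint → ZMod 2,
      (∀ x, c x.rot = c x + 1) ∧ ∀ x, c (T.arc x) = c x + 1 :=
  PunctTangle.exists_checkerboard Leg.rot_bijective T.arc_arc T.arc_ne
    (fun u hu => Leg.sum_eq_zero u hu) hT

/-- Both 2k and 2l are odd multiples of n, so their difference is an even multiple: there is only
one half-period modulo n. -/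
lemma dvd_sub_of_dvd_two_mul {n k l : ℤ} (hk : n ∣ 2 * k) (hl : n ∣ 2 * l) (hk' : ¬n ∣ k)
    (hl' : ¬n ∣ l) : n ∣ k - l := by
  obtain ⟨a, ha⟩ := hk
  obtain ⟨b, hb⟩ := hl
  have odd : ∀ {c m : ℤ}, 2 * m = n * c → ¬n ∣ m → Odd c := by
    intro c m h hm
    by_contra hc
    obtain ⟨d, rfl⟩ := even_iff_two_dvd.1 (Int.not_odd_iff_even.1 hc)
    exact hm ⟨d, by linarith⟩
  obtain ⟨q, hq⟩ := even_iff_two_dvd.1 ((odd ha hk').sub_odd (odd hb hl'))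
  exact ⟨q, by
    have : n * (a - b) = n * (2 * q) := by rw [hq]
    linarith⟩

/-! ### Orbits of two involutions -/

section Dihedral

variable {D : Type} {a s : Equiv.Perm D} {x y z : D}

/-- Conjugation by `s` inverts `s * a`. From a fixed point of `s`, the powers of `s * a` therefore
already sweep out the whole orbit of the group generated by both involutions. -/
lemma involution_zpow_apply (ha : a * a = 1) (hs : s * s = 1) (hx : s x = x) (k : ℤ) :
    s (((s * a) ^ k) x) = ((s * a) ^ (-k)) x ∧ a (((s * a) ^ k) x) = ((s * a) ^ (-k - 1)) x := by
  have ha' : a⁻¹ = a := inv_eq_of_mul_eq_one_right ha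
  have hs' : s⁻¹ = s := inv_eq_of_mul_eq_one_right hs
  have h1 : s * (s * a) ^ k * s⁻¹ = (s * a) ^ (-k) := by
    rw [← conj_zpow, zpow_neg, ← inv_zpow, mul_inv_rev, ha', hs', ← mul_assoc s s, hs, one_mul]
  have h2 : s (((s * a) ^ k) x) = ((s * a) ^ (-k)) x := by
    rw [← h1, Equiv.Perm.mul_apply, Equiv.Perm.mul_apply, hs', hx]
  have h3 : a = (s * a)⁻¹ * s := by rw [mul_inv_rev, ha', hs', mul_assoc, hs, mul_one]
  refine ⟨h2, ?_⟩
  have h4 : ∀ w, a w = (s * a)⁻¹ (s w) := fun w => by rw [← Equiv.Perm.mul_apply, ← h3]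
  rw [h4, h2, ← Equiv.Perm.mul_apply, ← zpow_neg_one, ← zpow_add]
  congr 2; ring

/-- An orbit of the group generated by two involutions contains at most two fixed points of
the second one. -/
lemma eq_of_fixed_of_orbit (ha : a * a = 1) (hs : s * s = 1) (hx : s x = x) (hy : s y = y)
    (hz : s z = z) (hxy : ∃ k : ℤ, ((s * a) ^ k) x = y) (hxz : ∃ k : ℤ, ((s * a) ^ k) x = z)
    (hyx : y ≠ x) (hzx : z ≠ x) : y = z := by
  obtain ⟨k, rfl⟩ := hxy
  obtain ⟨l, rfl⟩ := hxz
  have key : ∀ m : ℤ, ((s * a) ^ m) x = x ↔ (MulAction.period (s * a) x : ℤ) ∣ m :=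
    fun m => MulAction.zpow_smul_eq_iff_period_dvd (g := s * a) (a := x) (j := m)
  -- A fixed point at position `m` satisfies m ≡ -m modulo the period; apart from `x` itself only
  -- the half-period remains.
  have two : ∀ m : ℤ, s (((s * a) ^ m) x) = ((s * a) ^ m) x →
      (MulAction.period (s * a) x : ℤ) ∣ 2 * m := by
    intro m h
    rw [(involution_zpow_apply ha hs hx m).1] at h
    rw [← key, two_mul, zpow_add, Equiv.Perm.mul_apply, ← h, ← Equiv.Perm.mul_apply, ← zpow_add]
    simp
  have h := dvd_sub_of_dvd_two_mul (two k hy) (two l hz) (mt (key k).2 hyx) (mt (key l).2 hzx)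
  rw [← key] at h
  have h' : ((s * a) ^ k) x = ((s * a) ^ l) (((s * a) ^ (k - l)) x) := by
    rw [← Equiv.Perm.mul_apply, ← zpow_add]; congr 2; ring
  rw [h', h]

end Dihedral

/-! ### Strands of a resolved planar ball tangle -/

namespace TangleDiagram

variable {H V : Type} (T : TangleDiagram H) (σ : T.Crossing → Bool)

/-- The legs joined inside the vertices by the state `σ`; the boundary points are fixed. -/
def strandSwap : Equiv.Perm (Leg H T.Crossing T.Joint) :=
  Function.Involutive.toPerm (fun
    | .outer j => .outer j
    | .hole h j => .hole h j
    | .crossing c j => .crossing c (splitIndex (σ c) j)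
    | .joint p s => .joint p (!s)) (by
      rintro (_ | _ | _ | _) <;> simp [splitIndex_splitIndex])

lemma strandSwap_mul_self : T.strandSwap σ * T.strandSwap σ = 1 :=
  Equiv.ext fun x => Function.Involutive.toPerm_involutive _ x

variable {T σ}

lemma isInvariant_iff {g : Leg H T.Crossing T.Joint → V} :
    T.IsInvariant σ g ↔ (∀ x, g (T.arc x) = g x) ∧ ∀ x, g (T.strandSwap σ x) = g x := by
  constructor
  · rintro ⟨ha, hc, hj⟩
    refine ⟨ha, ?_⟩
    rintro (_ | _ | _ | _)
    exacts [rfl, rfl, hc _ _, hj _ _]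
  · rintro ⟨ha, hs⟩
    exact ⟨ha, fun c j => hs (.crossing c j), fun p s => hs (.joint p s)⟩

/-- The alternating sum of the boundary values of an invariant function vanishes. -/
lemma IsInvariant.alternating_sum [Finite H] [IsEmpty H] (hT : T.IsPlanar)
    {k : Leg H T.Crossing T.Joint → ℤ} (hk : T.IsInvariant σ k) :
    k (.outer 0) - k (.outer 1) + k (.outer 2) - k (.outer 3) = 0 := by
  obtain ⟨c, hrot, harc⟩ := hT.exists_checkerboard
  have := Fintype.ofFinite (Leg H T.Crossing T.Joint)
  let χ : ZMod 2 → ℤ := fun z => if z = 0 then 1 else -1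
  have hχ : ∀ z, χ (z + 1) = -χ z := by decide
  have hχ' : ∀ z, χ z ≠ 0 := by decide
  let F := fun x => k x * χ (c x)
  have h0 : ∑ x, F x = 0 := by
    have hb : T.arc.Bijective := Function.Involutive.bijective T.arc_arc
    have h1 := hb.sum_comp F
    have h2 : ∀ x, F (T.arc x) = -F x := fun x => by simp only [F, hk.arc, harc, hχ, mul_neg]
    simp only [h2, Finset.sum_neg_distrib] at h1
    linarith
  have h1 : ∑ x, (F x + F (T.strandSwap σ x)) = 0 := by
    rw [Finset.sum_add_distrib, Equiv.sum_comp, h0, add_zero]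
  -- A splitting joins neighbouring legs of a crossing, which have opposite colours. Inside the
  -- diagram everything cancels, and only the outer points, fixed by `strandSwap`, survive.
  have h2 : ∑ j : Fin 4, 2 * F (.outer j) = ∑ x, (F x + F (T.strandSwap σ x)) := by
    refine Fintype.sum_of_injective Leg.outer (fun i j h => by simpa using h) _ _ ?_ ?_
    · rintro (j | ⟨h, _⟩ | ⟨v, j⟩ | ⟨p, s⟩) hx
      · exact absurd ⟨j, rfl⟩ hx
      · exact isEmptyElim h
      · have hc : c (.crossing v (splitIndex (σ v) j)) = c (.crossing v j) + 1 := by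
          have h3 : ∀ b j, splitIndex b j = j + 1 ∨ j = splitIndex b j + 1 := by decide
          rcases h3 (σ v) j with h | h
          · rw [h]; exact hrot (.crossing v j)
          · have h4 : c (.crossing v j) = c (.crossing v (splitIndex (σ v) j)) + 1 := by
              conv_lhs => rw [h]
              exact hrot (.crossing v (splitIndex (σ v) j))
            rw [h4, add_assoc, CharTwo.add_self_eq_zero, add_zero]
        change k _ * χ _ + k (.crossing v (splitIndex (σ v) j)) *
          χ (c (.crossing v (splitIndex (σ v) j))) = 0
        rw [hc, hχ, hk.crossing]; ring
      · change k _ * χ _ + k (.joint p (!s)) * χ (c (.joint p (!s))) = 0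
        have hc : c (.joint p (!s)) = c (.joint p s) + 1 := hrot (.joint p s)
        rw [hc, hχ, hk.joint]; ring
    · intro j
      rw [two_mul]; rfl
  rw [h1, Fin.sum_univ_four] at h2
  have hc : ∀ j, χ (c (.outer j)) = -χ (c (.outer (j - 1))) := fun j => by
    have h3 : c (.outer (j - 1)) = c (.outer j) + 1 := hrot (.outer j)
    rw [h3, hχ, neg_neg]
  have hc1 := hc 1
  have hc2 := hc 2
  have hc3 := hc 3
  simp only [Fin.isValue, show (1 : Fin 4) - 1 = 0 by decide, show (2 : Fin 4) - 1 = 1 by decide,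
    show (3 : Fin 4) - 1 = 2 by decide] at hc1 hc2 hc3
  simp only [F] at h2
  rw [hc3, hc2, hc1] at h2
  have h5 : (k (.outer 0) - k (.outer 1) + k (.outer 2) - k (.outer 3)) * χ (c (.outer 0)) = 0 := by
    linarith
  exact (mul_eq_zero.1 h5).resolve_right (hχ' _)

variable (T σ)

/-- The legs `x` and `y` lie on the same component of the resolution. -/
def SameStrand (x y : Leg H T.Crossing T.Joint) : Prop :=
  ∀ g : Leg H T.Crossing T.Joint → Bool, T.IsInvariant σ g → g x = g y

variable {T σ}

lemma isInvariant_sameStrand (y : Leg H T.Crossing T.Joint) :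
    T.IsInvariant σ fun x => T.SameStrand σ x y where
  arc x := by
    refine propext (forall₂_congr fun g hg => ?_)
    rw [hg.arc]
  crossing c j := by
    refine propext (forall₂_congr fun g hg => ?_)
    rw [hg.crossing]
  joint p s := by
    refine propext (forall₂_congr fun g hg => ?_)
    rw [hg.joint]

lemma IsInvariant.comp {W : Type} {g : Leg H T.Crossing T.Joint → V} (hg : T.IsInvariant σ g)
    (φ : V → W) : T.IsInvariant σ fun x => φ (g x) :=
  ⟨fun x => congrArg φ (hg.arc x), fun c j => congrArg φ (hg.crossing c j),
    fun p s => congrArg φ (hg.joint p s)⟩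

/-- The indicator of the orbit of the end `i` is invariant, so a leg that no invariant function
separates from `i` lies in that orbit. The boundary points are the fixed points of `strandSwap`, so
the bound on fixed points in an orbit applies to strands. -/
lemma SameStrand.exists_zpow {i : Fin 4} {y : Leg H T.Crossing T.Joint}
    (h : T.SameStrand σ y (.outer i)) :
    ∃ k : ℤ, ((T.strandSwap σ * Function.Involutive.toPerm T.arc T.arc_arc) ^ k) (.outer i) =
      y := by
  classical
  set s := T.strandSwap σ
  set a := Function.Involutive.toPerm T.arc T.arc_arc
  have ha2 : a * a = 1 := Equiv.ext fun x => T.arc_arc x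
  have hs2 : s * s = 1 := T.strandSwap_mul_self σ
  have key := involution_zpow_apply (x := .outer i) ha2 hs2 rfl
  have hinv : T.IsInvariant σ fun z => decide (∃ k : ℤ, ((s * a) ^ k) (.outer i) = z) := by
    have h1 : ∀ z, (∃ k : ℤ, ((s * a) ^ k) (.outer i) = z) →
        ∃ k : ℤ, ((s * a) ^ k) (.outer i) = a z := by
      rintro _ ⟨k, rfl⟩; exact ⟨_, (key k).2.symm⟩
    have h2 : ∀ z, (∃ k : ℤ, ((s * a) ^ k) (.outer i) = z) →
        ∃ k : ℤ, ((s * a) ^ k) (.outer i) = s z := by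
      rintro _ ⟨k, rfl⟩; exact ⟨_, (key k).1.symm⟩
    refine isInvariant_iff.2 ⟨fun z => decide_eq_decide.2 ⟨fun h => ?_, h1 z⟩,
      fun z => decide_eq_decide.2 ⟨fun h => ?_, h2 z⟩⟩
    · have := h1 _ h
      rwa [show a (T.arc z) = z from T.arc_arc z] at this
    · have := h2 _ h
      rwa [← Equiv.Perm.mul_apply, hs2] at this
  have := h _ hinv
  simpa using this.trans (decide_eq_true ⟨0, by simp⟩)

lemma SameStrand.outer_unique {i j k : Fin 4} (hj : T.SameStrand σ (.outer j) (.outer i))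
    (hk : T.SameStrand σ (.outer k) (.outer i)) (hji : j ≠ i) (hki : k ≠ i) : j = k := by
  have := eq_of_fixed_of_orbit (Equiv.ext fun x => T.arc_arc x) (T.strandSwap_mul_self σ) rfl rfl rfl
    hj.exists_zpow hk.exists_zpow (by simpa using hji) (by simpa using hki)
  simpa using this

/-- The ends of a resolved planar ball tangle are paired as in a fundamental tangle. -/
lemma IsPlanar.exists_sameStrand_iff [Finite H] [IsEmpty H] (hT : T.IsPlanar) :
    ∃ t, ∀ i j, T.SameStrand σ (.outer i) (.outer j) ↔ i = j ∨ i = fundamentalIndex t j := by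
  classical
  have hsymm : ∀ {i j}, T.SameStrand σ (.outer i) (.outer j) →
    T.SameStrand σ (.outer j) (.outer i) := fun h g hg => (h g hg).symm
  have hrefl : ∀ i, T.SameStrand σ (.outer i) (.outer i) := fun i g hg => rfl
  -- The alternating sum for the indicator of the strand through `i` forces that strand to have as
  -- many even as odd ends.
  have halt := fun i => ((isInvariant_sameStrand (T := T) (σ := σ) (.outer i)).comp
    fun p => if p then (1 : ℤ) else 0).alternating_sum hT
  suffices ∃ t, ∀ j, T.SameStrand σ (.outer (fundamentalIndex t j)) (.outer j) by
    obtain ⟨t, ht⟩ := this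
    have hne : ∀ t j, fundamentalIndex t j ≠ j := by decide
    refine ⟨t, fun i j => ⟨fun h => ?_, ?_⟩⟩
    · by_contra! hij
      exact hij.2 (h.outer_unique (ht j) hij.1 (hne t j))
    · rintro (rfl | rfl)
      exacts [hrefl _, ht j]
  have h0 := halt 0
  have h2 := halt 2
  simp only [if_pos (hrefl _)] at h0 h2
  have h01 : T.SameStrand σ (.outer 1) (.outer 0) ∨ T.SameStrand σ (.outer 3) (.outer 0) := by
    by_contra! h
    rw [if_neg h.1, if_neg h.2] at h0
    split_ifs at h0 <;> omega
  have h21 : T.SameStrand σ (.outer 1) (.outer 2) ∨ T.SameStrand σ (.outer 3) (.outer 2) := by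
    by_contra! h
    rw [if_neg h.1, if_neg h.2] at h2
    split_ifs at h2 <;> omega
  -- Ends 0 and 2 cannot share a partner, since that strand would have three ends.
  have hx : ∀ i, T.SameStrand σ (.outer i) (.outer 0) → T.SameStrand σ (.outer i) (.outer 2) →
      i = 0 ∨ i = 2 := by
    intro i hi hi'
    by_contra! h
    have := (hsymm hi).outer_unique (hsymm hi') h.1.symm h.2.symm
    simp at this
  rcases h01 with h | h <;> rcases h21 with h' | h'
  · simpa using hx _ h h'
  · refine ⟨1, fun j => ?_⟩
    fin_cases j
    exacts [h, hsymm h, h', hsymm h']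
  · refine ⟨0, fun j => ?_⟩
    fin_cases j
    exacts [h, hsymm h', h', hsymm h]
  · simpa using hx _ h h'

variable (T σ) in
/-- The resolution of `T` by `σ` is the fundamental tangle `t`, without closed components. -/
def IsOfType (t : Fin 2) : Prop :=
  (∀ g : Leg H T.Crossing T.Joint → Bool, T.IsInvariant σ g → ∀ b,
    (∀ j, g (.outer j) = b) → ∀ x, g x = b) ∧
  ∀ w : Fin 4 → Bool, (∃ g, T.IsInvariant σ g ∧ ∀ j, g (.outer j) = w j) ↔
    ∀ j, w (fundamentalIndex t j) = w j

/-- Boundary values compatible with the pairing of the ends extend along the strands; the extension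
chosen is false on closed components. Closed components are not excluded here. -/
lemma IsPlanar.exists_boundary_iff [Finite H] [IsEmpty H] (hT : T.IsPlanar) :
    ∃ t, ∀ w : Fin 4 → Bool, (∃ g, T.IsInvariant σ g ∧ ∀ j, g (.outer j) = w j) ↔
      ∀ j, w (fundamentalIndex t j) = w j := by
  classical
  obtain ⟨t, ht⟩ := hT.exists_sameStrand_iff (σ := σ)
  refine ⟨t, fun w => ⟨?_, fun hw => ?_⟩⟩
  · rintro ⟨g, hg, hgw⟩ j
    rw [← hgw, ← hgw]
    exact (ht _ j).2 (Or.inr rfl) g hg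
  · refine ⟨fun x => decide (∃ j, w j ∧ T.SameStrand σ x (.outer j)), ?_, fun j => ?_⟩
    · have h := fun j => isInvariant_sameStrand (T := T) (σ := σ) (.outer j)
      refine ⟨fun x => ?_, fun c i => ?_, fun p s => ?_⟩ <;> simp only [decide_eq_decide] <;>
        refine exists_congr fun j => and_congr_right fun _ => iff_of_eq ?_
      exacts [(h j).arc x, (h j).crossing c i, (h j).joint p s]
    · rw [Bool.eq_iff_iff, decide_eq_true_iff]
      constructor
      · rintro ⟨i, hi, h⟩
        rcases (ht _ _).1 h with rfl | rfl
        · exact hi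
        · rw [hw]; exact hi
      · intro h
        exact ⟨j, h, fun g hg => rfl⟩

lemma IsOfType.unique {t t' : Fin 2} (h : T.IsOfType σ t) (h' : T.IsOfType σ t') : t = t' := by
  have hw := fun w => (h.2 w).symm.trans (h'.2 w)
  have key : ∀ t t' : Fin 2, ((∀ j, (fun i => decide (i = 0 ∨ i = fundamentalIndex t 0))
      (fundamentalIndex t j) = (fun i => decide (i = 0 ∨ i = fundamentalIndex t 0)) j) ↔
      (∀ j, (fun i => decide (i = 0 ∨ i = fundamentalIndex t 0))
      (fundamentalIndex t' j) = (fun i => decide (i = 0 ∨ i = fundamentalIndex t 0)) j)) →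
      t = t' := by decide
  exact key t t' (hw fun i => decide (i = 0 ∨ i = fundamentalIndex t 0))

/-- `closureIndex r` is the pairing complementary to `fundamentalIndex r`, and the two together join
all four ends in one cycle. For the other type both pairings coincide and the closure has at least
two circles. -/
lemma IsPlanar.isConnectedState_closure_iff [Finite H] [IsEmpty H] (hT : T.IsPlanar)
    (r : Fin 2) : (T.closure r).IsConnectedState σ ↔ T.IsOfType σ r := by
  rw [TangleDiagram.isConnectedState_closure_iff]
  constructor
  · intro h
    have hclean : ∀ g : Leg H T.Crossing T.Joint → Bool, T.IsInvariant σ g → ∀ b,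
        (∀ j, g (.outer j) = b) → ∀ x, g x = b := by
      intro g hg b hb x
      rw [← hb 0]
      exact h g hg (fun j => by rw [hb, hb]) _ _
    obtain ⟨t, ht⟩ := hT.exists_boundary_iff (σ := σ)
    suffices t = r by subst this; exact ⟨hclean, ht⟩
    by_contra htr
    have key : ∀ t r : Fin 2, t ≠ r →
        (∀ j, decide (fundamentalIndex t j = 0 ∨ fundamentalIndex t j = fundamentalIndex t 0) =
          decide (j = 0 ∨ j = fundamentalIndex t 0)) ∧
        (∀ j, decide (closureIndex r j = 0 ∨ closureIndex r j = fundamentalIndex t 0) =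
          decide (j = 0 ∨ j = fundamentalIndex t 0)) ∧
        ¬ ∀ j, decide (j = 0 ∨ j = fundamentalIndex t 0) = true := by decide
    obtain ⟨k1, k2, k3⟩ := key t r htr
    -- The strand through `NE` closes up by itself, so its indicator contradicts connectedness.
    obtain ⟨g, hg, hgw⟩ := (ht fun j => decide (j = 0 ∨ j = fundamentalIndex t 0)).2 k1
    refine k3 fun j => ?_
    rw [← hgw, h g hg (fun j => by rw [hgw, hgw, k2]) (.outer j) (.outer 0), hgw]
    simp
  · intro h g hg hc x y
    have h1 := (h.2 fun j => g (.outer j)).1 ⟨g, hg, fun _ => rfl⟩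
    have key : ∀ (r : Fin 2) (w : Fin 4 → Bool), (∀ j, w (fundamentalIndex r j) = w j) →
        (∀ j, w (closureIndex r j) = w j) → ∀ j, w j = w 0 := by decide
    have h2 := h.1 g hg _ (key r (fun j => g (.outer j)) h1 hc)
    rw [h2, h2 y]

end TangleDiagram
-- Fundamental tangles in the five holes: a finite check
section Skeleton

/-- The end point `j` of the outer circle (`none`) or of a hole (`some h`), as a leg of `T5`. -/
def T5.leg : Option (Fin 5) × Fin 4 → Leg (Fin 5) T5.Crossing T5.Joint
  | (none, j) => .outer j
  | (some h, j) => .hole h j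

/-- The inverse of `T5.leg`. -/
def T5.point : Leg (Fin 5) T5.Crossing T5.Joint → Option (Fin 5) × Fin 4
  | .outer j => (none, j)
  | .hole h j => (some h, j)
  | .crossing c _ => Empty.elim c
  | .joint p _ => Empty.elim p

lemma T5.leg_point (x : Leg (Fin 5) T5.Crossing T5.Joint) : T5.leg (T5.point x) = x := by
  rcases x with _ | _ | c | p
  exacts [rfl, rfl, Empty.elim c, Empty.elim p]

/-- The strand segments of `T5`. -/
def T5.arcPoint (p : Option (Fin 5) × Fin 4) : Option (Fin 5) × Fin 4 :=
  T5.point (T5.arc (T5.leg p))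

/-- The fundamental tangles in the holes and the closing arcs outside. -/
def T5.swapPoint (t : Fin 5 → Fin 2) (r : Fin 2) :
    Option (Fin 5) × Fin 4 → Option (Fin 5) × Fin 4
  | (none, j) => (none, closureIndex r j)
  | (some h, j) => (some h, fundamentalIndex (t h) j)

/-- Every second point of the circle through `NE` in a closure of `T5`. -/
def T5.orbit (t : Fin 5 → Fin 2) (r : Fin 2) : List (Option (Fin 5) × Fin 4) :=
  -- There are 24 end points, and a circle alternates between two orbits of equal size, so 12
  -- iterates are enough.
  List.iterate (fun p => T5.swapPoint t r (T5.arcPoint p)) (none, 0) 12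

/-- A numbering of the end points. -/
def T5.code : Option (Fin 5) × Fin 4 → ℕ
  | (none, j) => j
  | (some h, j) => 4 * h + 4 + j

lemma T5.code_injective : T5.code.Injective := by
  rintro ⟨_ | h, j⟩ ⟨_ | h', j'⟩ hc <;> simp only [T5.code] at hc <;>
    simp only [Prod.mk.injEq, Option.some.injEq, reduceCtorEq, false_and, true_and, Fin.ext_iff] <;>
    omega

/-- The set of the points of a list and of their partners under `T5.arcPoint`, as a binary
number. -/
def T5.mask (l : List (Option (Fin 5) × Fin 4)) : ℕ :=
  l.foldr (fun p m => m ||| 2 ^ T5.code p ||| 2 ^ T5.code (T5.arcPoint p)) 0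

lemma T5.exists_mem_of_testBit_mask {l : List (Option (Fin 5) × Fin 4)}
    {q : Option (Fin 5) × Fin 4} (h : (T5.mask l).testBit (T5.code q) = true) :
    ∃ p ∈ l, q = p ∨ q = T5.arcPoint p := by
  induction l with
  | nil => simp [T5.mask] at h
  | cons p l ih =>
    rw [T5.mask, List.foldr_cons, ← T5.mask, Nat.testBit_or, Nat.testBit_or, Nat.testBit_two_pow,
      Nat.testBit_two_pow, Bool.or_eq_true, Bool.or_eq_true, decide_eq_true_iff,
      decide_eq_true_iff] at h
    rcases h with (h | h) | h
    · obtain ⟨p', hp', hq⟩ := ih h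
      exact ⟨p', List.mem_cons_of_mem _ hp', hq⟩
    · exact ⟨p, List.mem_cons_self, Or.inl (T5.code_injective h).symm⟩
    · exact ⟨p, List.mem_cons_self, Or.inr (T5.code_injective h).symm⟩

/-- The circle through `NE` in a closure of `T5` whose holes are filled by fundamental tangles. -/
def T5.circle (t : Fin 5 → Fin 2) (r : Fin 2) (p : Option (Fin 5) × Fin 4) : Bool :=
  (T5.mask (T5.orbit t r)).testBit (T5.code p)

/-- The fillings of the corners, of the centre by the tangle `a`, and the closures `r`, that give
a single circle. -/
def T5.IsCircle (t₀ t₁ t₂ t₃ a r : Fin 2) : Prop :=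
  match r, a with
  | 0, 0 => t₀.val + t₁ + t₂ + t₃ = 1
  | 0, 1 => t₀ ≠ t₁ ∧ t₂ ≠ t₃
  | 1, 0 => t₀ ≠ t₂ ∧ t₁ ≠ t₃
  | 1, 1 => t₀.val + t₁ + t₂ + t₃ = 3

instance (t₀ t₁ t₂ t₃ a r : Fin 2) : Decidable (T5.IsCircle t₀ t₁ t₂ t₃ a r) :=
  match r, a with
  | 0, 0 => inferInstanceAs (Decidable (t₀.val + t₁ + t₂ + t₃ = 1))
  | 0, 1 => inferInstanceAs (Decidable (t₀ ≠ t₁ ∧ t₂ ≠ t₃))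
  | 1, 0 => inferInstanceAs (Decidable (t₀ ≠ t₂ ∧ t₁ ≠ t₃))
  | 1, 1 => inferInstanceAs (Decidable (t₀.val + t₁ + t₂ + t₃ = 3))

/-- All 64 cases are evaluated. The first two clauses certify that the computed set is a union of
circles; storing it as a binary number keeps the evaluation cheap. -/
lemma T5.circle_spec : ∀ t₀ t₁ t₂ t₃ a r : Fin 2,
    (∀ p, T5.circle ![t₀, t₁, t₂, t₃, a] r (T5.arcPoint p) =
      T5.circle ![t₀, t₁, t₂, t₃, a] r p) ∧
    (∀ p, T5.circle ![t₀, t₁, t₂, t₃, a] r (T5.swapPoint ![t₀, t₁, t₂, t₃, a] r p) =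
      T5.circle ![t₀, t₁, t₂, t₃, a] r p) ∧
    ((∀ p, T5.circle ![t₀, t₁, t₂, t₃, a] r p = true) ↔ T5.IsCircle t₀ t₁ t₂ t₃ a r) ∧
    T5.circle ![t₀, t₁, t₂, t₃, a] r (none, 0) = true := by
  decide +kernel

/-- The computed circle is itself a test function, which gives one direction. Conversely, an
invariant function is constant on that circle, so it is constant if the circle contains every point.
-/
lemma T5.forall_eq_iff (t : Fin 5 → Fin 2) (r : Fin 2) :
    (∀ u : Leg (Fin 5) T5.Crossing T5.Joint → Bool, (∀ x, u (T5.arc x) = u x) →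
      (∀ h j, u (.hole h (fundamentalIndex (t h) j)) = u (.hole h j)) →
      (∀ j, u (.outer (closureIndex r j)) = u (.outer j)) → ∀ x, u x = u (.outer 0)) ↔
    T5.IsCircle (t 0) (t 1) (t 2) (t 3) (t 4) r := by
  obtain ⟨h1, h2, h3, h4⟩ := T5.circle_spec (t 0) (t 1) (t 2) (t 3) (t 4) r
  have ht : ![t 0, t 1, t 2, t 3, t 4] = t := by
    ext h; fin_cases h <;> rfl
  rw [ht] at h1 h2 h3 h4
  rw [← h3]
  constructor
  · intro h p
    have := h (fun x => T5.circle t r (T5.point x)) (fun x => ?_) (fun i j => h2 (some i, j))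
      (fun j => h2 (none, j)) (T5.leg p)
    · rcases p with ⟨_ | _, _⟩ <;> exact this.trans h4
    · have := h1 (T5.point x)
      rwa [T5.arcPoint, T5.leg_point] at this
  · intro h u ha hh ho x
    have key : ∀ (n : ℕ) (p q : Option (Fin 5) × Fin 4),
        q ∈ List.iterate (fun p => T5.swapPoint t r (T5.arcPoint p)) p n →
          u (T5.leg q) = u (T5.leg p) := by
      intro n
      induction n with
      | zero => intro p q hq; simp at hq
      | succ n ih =>
        intro p q hq
        rw [List.iterate, List.mem_cons] at hq
        rcases hq with rfl | hq
        · rfl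
        · have hs : ∀ p, u (T5.leg (T5.swapPoint t r p)) = u (T5.leg p) := by
            rintro ⟨_ | i, j⟩
            exacts [ho j, hh i j]
          rw [ih _ _ hq, hs, T5.arcPoint, T5.leg_point, ha]
    have hx := h (T5.point x)
    obtain ⟨p, hp, hpx⟩ := T5.exists_mem_of_testBit_mask hx
    refine Eq.trans ?_ (key _ _ _ hp)
    rw [← T5.leg_point x]
    rcases hpx with h | h
    · rw [h]
    · rw [h, T5.arcPoint, T5.leg_point, ha]

end Skeleton

/-! ### Gluing invariant functions over the pieces of `X` -/

namespace TangleDiagram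

variable {H V : Type}

lemma exists_isInvariant_fill [Fintype H] [DecidableEq H] {K : H → Type} (T : TangleDiagram H)
    (B : ∀ h, TangleDiagram (K h)) (σ : (T.fill B).Crossing → Bool)
    (u : Leg H T.Crossing T.Joint → V) (hu : T.IsInvariant (fun c => σ (.inl c)) u)
    (g : ∀ h, Leg (K h) (B h).Crossing (B h).Joint → V)
    (hg : ∀ h, (B h).IsInvariant (fun c => σ (.inr ⟨h, c⟩)) (g h))
    (hj : ∀ h j, g h (.outer j) = u (.hole h j)) :
    ∃ G : Leg (Σ h, K h) (T.fill B).Crossing (T.fill B).Joint → V, (T.fill B).IsInvariant σ G ∧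
      (∀ x, G (fillLegs T B (.inl x)) = u x) ∧ ∀ h x, G (fillLegs T B (.inr ⟨h, x⟩)) = g h x := by
  have h1 : ∀ x, (Sum.elim u (fun p : Σ h, Leg (K h) (B h).Crossing (B h).Joint => g p.1 p.2))
      ((fillLegs T B).symm (fillLegs T B (.inl x))) = u x := fun x => by simp
  have h2 : ∀ h x, (Sum.elim u (fun p : Σ h, Leg (K h) (B h).Crossing (B h).Joint => g p.1 p.2))
      ((fillLegs T B).symm (fillLegs T B (.inr ⟨h, x⟩))) = g h x := fun h x => by simp
  refine ⟨fun x => Sum.elim u (fun p => g p.1 p.2) ((fillLegs T B).symm x), ?_, h1, h2⟩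
  rw [isInvariant_fill_iff]
  refine ⟨?_, fun h => ?_, fun h j => ?_⟩
  · simpa only [h1] using hu
  · simpa only [h2] using hg h
  · exact (h2 h _).trans ((hj h j).trans (h1 _).symm)

end TangleDiagram

section Gluing

variable (B : Fin 4 → PBT 0) (r : Fin 2) (α : Fin 1 → Fin 2)

/-- The crossings of `B i` as crossings of the closures of `X B`. -/
def crossingOfPiece : ∀ i : Fin 4, (B i).Crossing → ((X B).close r α).Crossing
  | 0, c => .inl (.inr ⟨0, c⟩)
  | 1, c => .inl (.inr ⟨1, c⟩)
  | 2, c => .inl (.inr ⟨2, c⟩)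
  | 3, c => .inl (.inr ⟨3, c⟩)

/-- `u` and the functions `g i` glue to an invariant function on a closure of `X B`. -/
structure IsGluing (τ : ∀ i, (B i).Crossing → Bool) (a : Fin 2)
    (u : Leg (Fin 5) T5.Crossing T5.Joint → Bool)
    (g : ∀ i, Leg (Fin 0) (B i).Crossing (B i).Joint → Bool) : Prop where
  arc : ∀ x, u (T5.arc x) = u x
  piece : ∀ i, (B i).IsInvariant (τ i) (g i)
  boundary : ∀ i j, g i (.outer j) = u (.hole i.castSucc j)
  centre : ∀ j, u (.hole 4 (fundamentalIndex a j)) = u (.hole 4 j)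
  outer : ∀ j, u (.outer (closureIndex r j)) = u (.outer j)

/-- The radial strands of `sphericalId` only carry values from the central hole of `T5` to the
fundamental tangle placed inside. Invariant functions on the closure are thus families on `T5` and
the four pieces, with the central tangle and the closing arcs as conditions. -/
lemma isConnectedState_close_X_iff (σ : ((X B).close r α).Crossing → Bool) :
    ((X B).close r α).IsConnectedState σ ↔
      ∀ u g, IsGluing B r (fun i c => σ (crossingOfPiece B r α i c)) (α 0) u g →
        (∀ x, u x = u (.outer 0)) ∧ ∀ i x, g i x = u (.outer 0) := by
  have : IsEmpty (Σ _ : Fin 1, Fin 0) := ⟨fun x => x.2.elim0⟩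
  let E : (Σ h, Fin (arity h)) ≃ Fin 1 := finSigmaFinEquiv.trans (finCongr (by decide))
  refine (TangleDiagram.isConnectedState_closure_iff
    ((X B).fill fun i => fundamental (α i)) r σ).trans ⟨fun h u g hg => ?_, fun h G hG hGo => ?_⟩
  · let g4 : Leg (Fin 1) Empty Empty → Bool := fun
      | .outer j => u (.hole 4 j)
      | .hole _ j => u (.hole 4 j)
      | .crossing c _ => c.elim
      | .joint p _ => p.elim
    let k : Leg (Fin 0) Empty Empty → Bool := fun
      | .outer j => u (.hole 4 j)
      | .hole h _ => h.elim0
      | .crossing c _ => c.elim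
      | .joint p _ => p.elim
    let g' : ∀ h, Leg (Fin (arity h)) (fillers B h).Crossing (fillers B h).Joint → Bool := fun
      | 0 => g 0
      | 1 => g 1
      | 2 => g 2
      | 3 => g 3
      | 4 => g4
    have hg4 : sphericalId.IsInvariant (fun c => σ (.inl (.inr ⟨4, c⟩))) g4 := by
      refine ⟨?_, fun c => Empty.elim c, fun p => Empty.elim p⟩
      rintro (j | ⟨h, j⟩ | c | p)
      exacts [rfl, rfl, Empty.elim c, Empty.elim p]
    obtain ⟨G₀, hG₀, hG₀u, hG₀g⟩ := TangleDiagram.exists_isInvariant_fill T5 (fillers B)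
      (fun c => σ (.inl c)) u ⟨hg.arc, fun c => Empty.elim c, fun p => Empty.elim p⟩ g'
      (fun h => by
        fin_cases h
        exacts [hg.piece 0, hg.piece 1, hg.piece 2, hg.piece 3, hg4])
      (fun h j => by
        fin_cases h
        exacts [hg.boundary 0 j, hg.boundary 1 j, hg.boundary 2 j, hg.boundary 3 j, rfl])
    have hG₁ : (X B).IsInvariant (fun c => σ (.inl c))
        (fun x => G₀ ((TangleDiagram.relabelLegs E).symm x)) := by
      refine (TangleDiagram.isInvariant_relabel_iff (T5.fill (fillers B)) E _ _).2 ?_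
      have h0 : (fun x => G₀ ((TangleDiagram.relabelLegs E).symm
          (TangleDiagram.relabelLegs E x))) = G₀ :=
        funext fun x => congrArg G₀ (Equiv.symm_apply_apply _ x)
      rw [h0]
      exact hG₀
    have hk : ∀ i, (fundamental (α i)).IsInvariant (fun c => σ (.inr ⟨i, c⟩)) k := by
      intro i
      refine ⟨?_, fun c => Empty.elim c, fun p => Empty.elim p⟩
      rw [Subsingleton.elim i 0]
      rintro (j | ⟨h, j⟩ | c | p)
      exacts [hg.centre j, h.elim0, Empty.elim c, Empty.elim p]
    obtain ⟨G, hG, hGX, hGk⟩ := TangleDiagram.exists_isInvariant_fill (X B)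
      (fun i => fundamental (α i)) σ _ hG₁ (fun _ => k) hk (fun i j => by
        -- The only hole of `X B` is the hole of the spherical tangle placed in hole 4.
        have h0 : E.symm i = ⟨4, (0 : Fin 1)⟩ := by
          rw [Equiv.symm_apply_eq]; exact Subsingleton.elim _ _
        change u (.hole 4 j) = G₀ (.hole (E.symm i) j)
        rw [h0]
        exact (hG₀g 4 (.hole (0 : Fin 1) j)).symm)
    have hGo : ∀ j, G (.outer j) = u (.outer j) := fun j => (hGX (.outer j)).trans (hG₀u (.outer j))
    have hc := h G hG (fun j => by rw [hGo, hGo, hg.outer])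
    have hleg : ∀ x, ∃ y, G y = G₀ x := fun x => ⟨_, (hGX (TangleDiagram.relabelLegs E x)).trans
      (congrArg G₀ ((TangleDiagram.relabelLegs E).symm_apply_apply x))⟩
    have hc₀ : ∀ x, G₀ x = u (.outer 0) := fun x => by
      obtain ⟨y, hy⟩ := hleg x
      rw [← hy, ← hGo 0]; exact hc _ _
    refine ⟨fun x => (hG₀u x).symm.trans (hc₀ _), fun i x => ?_⟩
    fin_cases i
    exacts [(hG₀g 0 x).symm.trans (hc₀ _), (hG₀g 1 x).symm.trans (hc₀ _),
      (hG₀g 2 x).symm.trans (hc₀ _), (hG₀g 3 x).symm.trans (hc₀ _)]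
  · obtain ⟨hX, hF, hXF⟩ := (TangleDiagram.isInvariant_fill_iff _ _ _ _).1 hG
    have hX' := (TangleDiagram.isInvariant_relabel_iff (T5.fill (fillers B)) E _ _).1 hX
    obtain ⟨hT, hP, hTP⟩ := (TangleDiagram.isInvariant_fill_iff _ _ _ _).1 hX'
    let LX := TangleDiagram.fillLegs (X B) fun i => fundamental (α i)
    let L5 := TangleDiagram.fillLegs T5 (fillers B)
    let LE := TangleDiagram.relabelLegs (C := (X B).Crossing) (J := (X B).Joint) E
    let u : Leg (Fin 5) T5.Crossing T5.Joint → Bool := fun x => G (LX (.inl (LE (L5 (.inl x)))))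
    let g' : ∀ h, Leg (Fin (arity h)) (fillers B h).Crossing (fillers B h).Joint → Bool :=
      fun h x => G (LX (.inl (LE (L5 (.inr ⟨h, x⟩)))))
    let g : ∀ i, Leg (Fin 0) (B i).Crossing (B i).Joint → Bool := fun
      | 0 => g' 0
      | 1 => g' 1
      | 2 => g' 2
      | 3 => g' 3
    have h4 : ∀ j, g' 4 (.hole (0 : Fin 1) j) = u (.hole 4 j) := fun j =>
      ((hP 4).arc (.outer j)).trans (hTP 4 j)
    have hk : ∀ i j, G (LX (.inr ⟨i, .outer j⟩)) = u (.hole 4 j) := fun i j => by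
      have h0 : E ⟨4, (0 : Fin 1)⟩ = i := Subsingleton.elim _ _
      refine (hXF i j).trans ?_
      rw [← h0]
      exact h4 j
    obtain ⟨hu, hgc⟩ := h u g ⟨hT.arc, fun i => by
        fin_cases i
        exacts [hP 0, hP 1, hP 2, hP 3], fun i j => by
        fin_cases i
        exacts [hTP 0 j, hTP 1 j, hTP 2 j, hTP 3 j], fun j => by
        rw [← hk 0, ← hk 0]; exact (hF 0).arc (.outer j), hGo⟩
    have hall : ∀ y, G y = u (.outer 0) := by
      intro y
      obtain ⟨y, rfl⟩ := LX.surjective y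
      rcases y with y | ⟨i, j | h | c | p⟩
      · obtain ⟨y, rfl⟩ := LE.surjective y
        obtain ⟨y, rfl⟩ := L5.surjective y
        rcases y with y | ⟨h, y⟩
        · exact hu y
        · fin_cases h
          · exact hgc 0 y
          · exact hgc 1 y
          · exact hgc 2 y
          · exact hgc 3 y
          · rcases y with j | ⟨h, j⟩ | c | p
            · exact (hTP 4 j).trans (hu _)
            · have h0 : h = (0 : Fin 1) := Subsingleton.elim (α := Fin 1) _ _
              subst h0
              exact (h4 j).trans (hu _)
            · exact Empty.elim c
            · exact Empty.elim p
      · exact (hk i j).trans (hu _)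
      · exact h.elim0
      · exact Empty.elim c
      · exact Empty.elim p
    intro x y
    rw [hall x, hall y]

/-- Once the types of the pieces are known, each piece affects the rest only through the pairing of
its ends, so it can be replaced by a fundamental tangle. -/
lemma isConnectedState_close_X_iff_exists (hB : ∀ i, (B i).IsPlanar)
    (σ : ((X B).close r α).Crossing → Bool) :
    ((X B).close r α).IsConnectedState σ ↔
      ∃ t : Fin 4 → Fin 2, (∀ i, (B i).IsOfType (fun c => σ (crossingOfPiece B r α i c)) (t i)) ∧
        T5.IsCircle (t 0) (t 1) (t 2) (t 3) (α 0) r := by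
  classical
  rw [isConnectedState_close_X_iff]
  set τ : ∀ i, (B i).Crossing → Bool := fun i c => σ (crossingOfPiece B r α i c)
  have main : ∀ t : Fin 4 → Fin 2, (∀ i, (B i).IsOfType (τ i) (t i)) →
      ((∀ u g, IsGluing B r τ (α 0) u g →
        (∀ x, u x = u (.outer 0)) ∧ ∀ i x, g i x = u (.outer 0)) ↔
      T5.IsCircle (t 0) (t 1) (t 2) (t 3) (α 0) r) := by
    intro t ht
    have hsk := T5.forall_eq_iff (Fin.snoc t (α 0) : Fin 5 → Fin 2) r
    refine Iff.trans ?_ hsk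
    constructor
    · intro h u ha hh ho
      have hex : ∀ i, ∃ g, (B i).IsInvariant (τ i) g ∧
          ∀ j, g (.outer j) = u (.hole i.castSucc j) := by
        intro i
        refine ((ht i).2 _).2 fun j => ?_
        have := hh i.castSucc j
        rwa [Fin.snoc_castSucc (α := fun _ => Fin 2)] at this
      choose g hg hgu using hex
      exact (h u g ⟨ha, hg, hgu, fun j => hh 4 j, ho⟩).1
    · intro h u g hg
      have hu := h u hg.arc (fun i j => by
        induction i using Fin.lastCases with
        | last => rw [Fin.snoc_last (α := fun _ => Fin 2)]; exact hg.centre j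
        | cast i =>
          rw [Fin.snoc_castSucc (α := fun _ => Fin 2), ← hg.boundary, ← hg.boundary]
          exact ((ht i).2 fun j => g i (.outer j)).1 ⟨g i, hg.piece i, fun _ => rfl⟩ j) hg.outer
      exact ⟨hu, fun i => (ht i).1 (g i) (hg.piece i) _ fun j =>
        (hg.boundary i j).trans (hu _)⟩
  constructor
  · intro h
    have hex : ∀ i, ∃ t, (B i).IsOfType (τ i) t := by
      intro i
      obtain ⟨t, ht⟩ := (hB i).exists_boundary_iff (σ := τ i)
      refine ⟨t, fun g₀ hg₀ b hb x => ?_, ht⟩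
      -- A function on one piece with constant boundary value extends by that constant to the whole
      -- diagram, so connectedness excludes closed components in the piece.
      have := (h (fun _ => b) (Function.update (fun _ _ => b) i g₀) ⟨fun _ => rfl, fun l => ?_,
        fun l j => ?_, fun _ => rfl, fun _ => rfl⟩).2 i x
      · simpa using this
      · by_cases hl : l = i
        · subst hl; simpa using hg₀
        · rw [Function.update_of_ne hl]; exact TangleDiagram.IsInvariant.const _ _ _
      · by_cases hl : l = i
        · subst hl; simpa using hb j
        · rw [Function.update_of_ne hl]
    choose t ht using hex
    exact ⟨t, ht, (main t ht).1 h⟩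
  · rintro ⟨t, ht, hc⟩
    exact (main t ht).2 hc

end Gluing
-- Factorization of the state sum
section StateSum

variable (B : Fin 4 → PBT 0) (r : Fin 2) (α : Fin 1 → Fin 2)

/-- The crossings of a closure of `X B` are those of the four ball tangles. -/
def crossingEquiv : (Σ i, (B i).Crossing) ≃ ((X B).close r α).Crossing where
  toFun p := crossingOfPiece B r α p.1 p.2
  invFun
    | .inl (.inr ⟨0, c⟩) => ⟨0, c⟩
    | .inl (.inr ⟨1, c⟩) => ⟨1, c⟩
    | .inl (.inr ⟨2, c⟩) => ⟨2, c⟩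
    | .inl (.inr ⟨3, c⟩) => ⟨3, c⟩
    | .inl (.inr ⟨4, c⟩) => Empty.elim c
    | .inl (.inl c) => Empty.elim c
    | .inr ⟨_, c⟩ => Empty.elim c
  left_inv := by
    rintro ⟨i, c⟩
    fin_cases i <;> rfl
  right_inv := by
    rintro ((c | ⟨h, c⟩) | ⟨_, c⟩)
    · exact Empty.elim c
    · fin_cases h
      exacts [rfl, rfl, rfl, rfl, Empty.elim c]
    · exact Empty.elim c

/-- Grouping the states by the types of the four pieces makes weights and conditions factor; the
factor of a piece is the bracket of the closure matching its type. States in which a piece has no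
type contribute nothing. -/
lemma bracket_close_X (hB : ∀ i, (B i).IsPlanar) :
    ((X B).close r α).bracket = ∑ t : Fin 4 → Fin 2,
      if T5.IsCircle (t 0) (t 1) (t 2) (t 3) (α 0) r then
        ∏ i, ((B i).closure (t i)).bracket else 0 := by
  classical
  let S : (Fin 4 → Fin 2) → Prop := fun t => T5.IsCircle (t 0) (t 1) (t 2) (t 3) (α 0) r
  have hpiece : ∀ i t, ((B i).closure t).bracket = ∑ σ : (B i).Crossing → Bool,
      if (B i).IsOfType σ t then ∏ c, splitWeight (σ c) else 0 := by
    intro i t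
    rw [LinkDiagram.bracket_eq_sum]
    refine Finset.sum_congr rfl fun σ _ => ?_
    exact if_congr ((hB i).isConnectedState_closure_iff t) rfl rfl
  have hclose : ((X B).close r α).bracket = ∑ τ : ∀ i, (B i).Crossing → Bool,
      if ∃ t, (∀ i, (B i).IsOfType (τ i) (t i)) ∧ S t then
        ∏ i, ∏ c, splitWeight (τ i c) else 0 := by
    rw [LinkDiagram.bracket_eq_sum]
    refine Fintype.sum_equiv (((crossingEquiv B r α).symm.arrowCongr (Equiv.refl Bool)).trans
      (Equiv.piCurry fun _ _ => Bool)) _ _ fun σ => ?_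
    refine if_congr (isConnectedState_close_X_iff_exists B r α hB σ) ?_ rfl
    rw [← (crossingEquiv B r α).prod_comp, Fintype.prod_sigma]
    rfl
  have hterm : ∀ τ : ∀ i, (B i).Crossing → Bool,
      (if ∃ t, (∀ i, (B i).IsOfType (τ i) (t i)) ∧ S t then
        ∏ i, ∏ c, splitWeight (τ i c) else 0) =
      ∑ t : Fin 4 → Fin 2, if S t then
        ∏ i, if (B i).IsOfType (τ i) (t i) then ∏ c, splitWeight (τ i c) else 0 else 0 := by
    intro τ
    -- By uniqueness of types at most one summand is nonzero, so the existential condition becomes a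
    -- sum without overcounting.
    simp only [Finset.prod_ite_zero, Finset.mem_univ, true_imp_iff, ← ite_and]
    split_ifs with h
    · obtain ⟨t, ht, hS⟩ := h
      rw [Finset.sum_eq_single t, if_pos ⟨hS, ht⟩]
      · intro t' _ hne
        rw [if_neg]
        rintro ⟨-, ht'⟩
        exact hne (funext fun i => (ht' i).unique (ht i))
      · intro h; exact absurd (Finset.mem_univ t) h
    · refine (Finset.sum_eq_zero fun t _ => ?_).symm
      rw [if_neg]
      rintro ⟨hS, ht⟩
      exact h ⟨t, ht, hS⟩
  rw [hclose]
  simp only [hterm]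
  rw [Finset.sum_comm]
  refine Finset.sum_congr rfl fun t _ => ?_
  by_cases hS : S t
  · have hS' : T5.IsCircle (t 0) (t 1) (t 2) (t 3) (α 0) r := hS
    simp only [if_pos hS, if_pos hS', hpiece, Finset.prod_univ_sum, Fintype.piFinset_univ]
  · have hS' : ¬T5.IsCircle (t 0) (t 1) (t 2) (t 3) (α 0) r := hS
    simp only [if_neg hS, if_neg hS', Finset.sum_const_zero]

end StateSum

/-! ### Roots of unity and integral representatives -/

lemma sum_fin_four_fun (φ : (Fin 4 → Fin 2) → ℂ) :
    ∑ t, φ t = ∑ a, ∑ b, ∑ c, ∑ d, φ ![a, b, c, d] := by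
  let e : (Fin 4 → Fin 2) ≃ Fin 2 × Fin 2 × Fin 2 × Fin 2 :=
    ⟨fun t => (t 0, t 1, t 2, t 3), fun p => ![p.1, p.2.1, p.2.2.1, p.2.2.2], fun t => by
      ext i; fin_cases i <;> rfl, fun p => rfl⟩
  rw [← e.symm.sum_comp]
  simp only [Fintype.sum_prod_type]
  rfl

/-- The integral multiples of a matrix by eighth roots of unity. -/
lemma integral_multiples_eq_pmClass {m n : Type} (M : Matrix m n ℤ) (W : Matrix m n ℂ) {z₀ : ℂ}
    (hz₀ : z₀ ^ 8 = 1) (hM : ∀ i j, (M i j : ℂ) = z₀ * W i j) :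
    {N : Matrix m n ℤ | ∃ z : ℂ, z ^ 8 = 1 ∧ ∀ i j, (N i j : ℂ) = z * W i j} = pmClass M := by
  have hz₀' : z₀ ≠ 0 := by rintro rfl; norm_num at hz₀
  ext N
  constructor
  · rintro ⟨z, hz, hN⟩
    have hNM : ∀ i j, z₀ * (N i j : ℂ) = z * M i j := fun i j => by rw [hN, hM]; ring
    by_cases h0 : ∀ i j, M i j = 0
    · refine Or.inl (Matrix.ext fun i j => ?_)
      have := hNM i j
      rw [h0, Int.cast_zero, mul_zero, mul_eq_zero, Int.cast_eq_zero] at this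
      rw [h0, this.resolve_left hz₀']
    · push Not at h0
      obtain ⟨i, j, hij⟩ := h0
      -- Eighth powers remove the roots of unity. One nonzero entry then fixes the ratio of the two
      -- roots as a sign, and this sign governs the whole matrix.
      have h8 : (N i j) ^ 8 = (M i j) ^ 8 := by
        have := congrArg (· ^ 8) (hNM i j)
        simp only [mul_pow, hz, hz₀, one_mul] at this
        exact_mod_cast this
      have hijC : (M i j : ℂ) ≠ 0 := Int.cast_ne_zero.2 hij
      rcases pow_eq_pow_iff_cases.1 h8 with h | h | ⟨h, -⟩
      · norm_num at h
      · have hzz : z₀ = z := mul_right_cancel₀ hijC (h ▸ hNM i j)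
        refine Or.inl (Matrix.ext fun k l => ?_)
        have := hNM k l
        rw [hzz] at this
        exact_mod_cast mul_left_cancel₀ (hzz ▸ hz₀') this
      · have hzz : -z₀ = z := by
          refine mul_right_cancel₀ hijC ?_
          rw [← hNM i j, h]; push_cast; ring
        refine Or.inr (Matrix.ext fun k l => ?_)
        have := hNM k l
        rw [← hzz, neg_mul, ← mul_neg] at this
        have := mul_left_cancel₀ hz₀' this
        rw [Matrix.neg_apply]
        exact_mod_cast this
  · rintro (rfl | rfl)
    · exact ⟨z₀, hz₀, hM⟩
    · refine ⟨-z₀, by rw [Even.neg_pow (by decide), hz₀], fun i j => ?_⟩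
      rw [Matrix.neg_apply, Int.cast_neg, hM, neg_mul]

lemma exists_root_of_f_eq {B : PBT 0} {p q : ℤ} (h : f B = pmClass !![p; q]) :
    ∃ z : ℂ, z ^ 8 = 1 ∧ (p : ℂ) = z * (B.closure 0).bracket ∧
      (q : ℂ) = Complex.I * z * (B.closure 1).bracket := by
  have hmem : !![p; q] ∈ f B := h ▸ Or.inl rfl
  obtain ⟨z, hz, hN⟩ := hmem
  exact ⟨z, hz, congrFun (congrFun hN 0) 0, congrFun (congrFun hN 1) 0⟩

lemma F_X_eq (B : Fin 4 → PBT 0) (hB : ∀ i, (B i).IsPlanar)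
    (p₁ p₂ p₃ p₄ q₁ q₂ q₃ q₄ : ℤ)
    (h₁ : f (B 0) = pmClass !![p₁; q₁]) (h₂ : f (B 1) = pmClass !![p₂; q₂])
    (h₃ : f (B 2) = pmClass !![p₃; q₃]) (h₄ : f (B 3) = pmClass !![p₄; q₄]) :
    F (X B) = pmClass
      !![p₁ * p₂ * p₃ * q₄ + p₁ * p₂ * q₃ * p₄ + p₁ * q₂ * p₃ * p₄ + q₁ * p₂ * p₃ * p₄,
          -(p₁ * q₂ * p₃ * q₄) - p₁ * q₂ * q₃ * p₄ - q₁ * p₂ * p₃ * q₄ - q₁ * p₂ * q₃ * p₄;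
        p₁ * p₂ * q₃ * q₄ + p₁ * q₂ * q₃ * p₄ + q₁ * p₂ * p₃ * q₄ + q₁ * q₂ * p₃ * p₄,
          -(p₁ * q₂ * q₃ * q₄) - q₁ * p₂ * q₃ * q₄ - q₁ * q₂ * p₃ * q₄ - q₁ * q₂ * q₃ * p₄] := by
  obtain ⟨z₁, hz₁, hp₁, hq₁⟩ := exists_root_of_f_eq h₁
  obtain ⟨z₂, hz₂, hp₂, hq₂⟩ := exists_root_of_f_eq h₂
  obtain ⟨z₃, hz₃, hp₃, hq₃⟩ := exists_root_of_f_eq h₃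
  obtain ⟨z₄, hz₄, hp₄, hq₄⟩ := exists_root_of_f_eq h₄
  have hI3 : Complex.I ^ 3 = -Complex.I := Complex.I_pow_three
  have hI4 : Complex.I ^ 4 = 1 := Complex.I_pow_four
  -- Each factor `q` carries one `Complex.I`. The upper left entry has exactly one `q` in each term,
  -- which dictates the extra factor; the powers of i and -i in `F` adjust the other entries.
  have hz₀ : (Complex.I * (z₁ * z₂ * z₃ * z₄)) ^ 8 = 1 := by
    rw [mul_pow, mul_pow, mul_pow, mul_pow, hz₁, hz₂, hz₃, hz₄,
      show (8 : ℕ) = 4 * 2 from rfl, pow_mul, hI4]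
    norm_num
  rw [← integral_multiples_eq_pmClass _ (Matrix.of fun (r : Fin 2) (k : Fin (2 ^ 1)) =>
    (-Complex.I) ^ expo 1 k * Complex.I ^ (r : ℕ) * ((X B).close r (dict 1 k)).bracket) hz₀]
  · ext N
    refine exists_congr fun z => and_congr_right fun _ => ?_
    rw [← Matrix.ext_iff]
    refine forall₂_congr fun i j => ?_
    simp only [Matrix.map_apply, Matrix.of_apply]
    rw [show ∀ a b c d : ℂ, a * b * c * d = c * (a * b * d) from fun _ _ _ _ => by ring]
  · have hd0 : dict 1 0 0 = 0 := by decide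
    have hd1 : dict 1 1 0 = 1 := by decide
    have he0 : expo 1 0 = 0 := by decide
    have he1 : expo 1 1 = 1 := by decide
    intro i j
    simp only [Matrix.of_apply, bracket_close_X B _ _ hB, sum_fin_four_fun]
    change Fin 2 at j
    fin_cases i <;> fin_cases j
    all_goals
      simp [hd0, hd1, he0, he1, T5.IsCircle, Fin.sum_univ_two, Fin.prod_univ_four, hp₁, hp₂,
        hp₃, hp₄, hq₁, hq₂, hq₃, hq₄]
      ring_nf
    simp only [hI3]
    ring

end PunctTangle

theorem theorem3p11 (B : Fin 4 → PunctTangle.PBT 0) (hB : ∀ i, (B i).IsPlanar)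
    (p₁ p₂ p₃ p₄ q₁ q₂ q₃ q₄ : ℤ)
    (h₁ : PunctTangle.f (B 0) = PunctTangle.pmClass !![p₁; q₁])
    (h₂ : PunctTangle.f (B 1) = PunctTangle.pmClass !![p₂; q₂])
    (h₃ : PunctTangle.f (B 2) = PunctTangle.pmClass !![p₃; q₃])
    (h₄ : PunctTangle.f (B 3) = PunctTangle.pmClass !![p₄; q₄]) :
    PunctTangle.F (PunctTangle.X B) = PunctTangle.pmClass
      !![p₁ * p₂ * p₃ * q₄ + p₁ * p₂ * q₃ * p₄ + p₁ * q₂ * p₃ * p₄ + q₁ * p₂ * p₃ * p₄,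
          -(p₁ * q₂ * p₃ * q₄) - p₁ * q₂ * q₃ * p₄ - q₁ * p₂ * p₃ * q₄ - q₁ * p₂ * q₃ * p₄;
        p₁ * p₂ * q₃ * q₄ + p₁ * q₂ * q₃ * p₄ + q₁ * p₂ * p₃ * q₄ + q₁ * q₂ * p₃ * p₄,
          -(p₁ * q₂ * q₃ * q₄) - q₁ * p₂ * q₃ * q₄ - q₁ * q₂ * p₃ * q₄ - q₁ * q₂ * q₃ * p₄] ∧
    ∀ N : Matrix (Fin 2) (Fin 2) ℤ, N ∈ PunctTangle.F (PunctTangle.X B) →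
      N.det = (p₁ * q₂ * q₃ * p₄ - q₁ * p₂ * p₃ * q₄) ^ 2 := by
  have h := PunctTangle.F_X_eq B hB p₁ p₂ p₃ p₄ q₁ q₂ q₃ q₄ h₁ h₂ h₃ h₄
  refine ⟨h, fun N hN => ?_⟩
  rw [h] at hN
  rcases hN with rfl | rfl
  -- Both representatives have the same determinant because the size is even.
  · rw [Matrix.det_fin_two_of]; ring
  · rw [Matrix.det_fin_two]
    simp only [Matrix.neg_apply, Matrix.of_apply, Matrix.cons_val', Matrix.cons_val_zero,
      Matrix.cons_val_one, Matrix.cons_val_fin_one]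
    ring
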